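/- Let $\beta\in(0,1]$. There are a constant $c>0$ and a function $C:\mathbb{R}^4\to\mathbb{R}$, both depending only on $\beta$, such that the following holds. Let $0<T<\infty$ and let $\widetilde u=\widetilde u(x,t)$ be a vector field on $\mathbb{R}^2\times(0,T)$ which, for almost every $t\in(0,T)$, is continuously differentiable in $x$ with $\nabla\cdot\widetilde u=0$, and which satisfies $$M\equiv\max\left\{\|\widetilde u\|_{L^\infty(0,T;L^2(\mathbb{R}^2))},\ \|\nabla\widetilde u\|_{L^\infty(0,T;L^\infty(\mathbb{R}^2))}\right\}<\infty .$$ Let $\theta$ be a smooth, spatially decaying solution on $[0,T]$ of $$\partial_t\theta+u\cdot\nabla\theta+\Lambda^\beta\theta=0,\qquad u=\widetilde u+v,\qquad v=-\nabla^\perp\Lambda^{-3+\beta}\partial_1\theta,\qquad \theta(x,0)=\theta_0(x),$$ where $\nabla^\perp=(-\partial_2,\partial_1)$ and $\Lambda^s$ is the Fourier multiplier with symbol $|\xi|^s$, $\widehat f(\xi)=\int_{\mathbb{R}^2}e^{-ix\cdot\xi}f(x)\,dx$. Here a smooth, spatially decaying solution means: $\theta(\cdot,t)\in C^\infty(\mathbb{R}^2)$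 for every $t\in[0,T]$; $\sup_{0\le t\le T}\|D^k\theta(\cdot,t)\|_{L^1(\mathbb{R}^2)}<\infty$ for $0\le k\le4$; $t\mapsto\theta(x,t)$ is Lipschitz on $[0,T]$, uniformly in $x$; and, for almost every $t\in(0,T)$, the equation holds at every $x\in\mathbb{R}^2$. Suppose that $\theta$ has only small shocks with parameter $\delta$ uniformly on $[0,T]$, that is, there is $L>0$ such that $$|\theta(x,t)-\theta(y,t)|\le\delta\quad\text{whenever } t\in[0,T],\ |x-y|<L,\qquad\text{where}\quad \delta=\frac{c}{\|\theta_0\|_{L^\infty}^{2\beta/(2-\beta)}}$$ ($\delta=\infty$ if $\theta_0=0$). Then $$\|\nabla\theta\|_{L^\infty(0,T;L^\infty(\mathbb{R}^2))}\le C\big(M,\|\theta_0\|_{L^\infty},\|\nabla\theta_0\|_{L^\infty},T\big).$$ -/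

import Mathlib

open MeasureTheory Set
open scoped ENNReal NNReal FourierTransform ContDiff

namespace GeneralizedSQG

/-- The plane with its Euclidean norm. -/
abbrev Plane : Type := EuclideanSpace ℝ (Fin 2)

noncomputable section

/-- The Fourier multiplier operator with symbol `m`, applied to a real function `f`. The symbol is
a function of the angular frequency, i.e. for the convention
`f̂(ξ) = ∫ exp(-i x·ξ) f(x) dx`; Mathlib's transform uses `exp(-2πi x·ξ)`, whence the factor `2π`.
For the symbols used below, which satisfy `m (-ξ) = conj (m ξ)`, the result is real-valued. -/
def multiplier (m : Plane → ℂ) (f : Plane → ℝ) (x : Plane) : ℝ :=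
  (𝓕⁻ (fun ξ : Plane => m ((2 * Real.pi) • ξ) * 𝓕 (fun y : Plane => (f y : ℂ)) ξ) x).re

/-- `Λ^s f`, where `Λ = √(-Δ)` has the symbol `|ξ|`. -/
def fracLaplacian (s : ℝ) (f : Plane → ℝ) : Plane → ℝ :=
  multiplier (fun ξ => ((‖ξ‖ ^ s : ℝ) : ℂ)) f

/-- The velocity `v = -∇^⊥ Λ^(-3+β) ∂₁ θ` with `∇^⊥ = (-∂₂, ∂₁)`; the symbol of `∂ⱼ` is `i ξⱼ`. -/
def inducedVelocity (β : ℝ) (f : Plane → ℝ) (x : Plane) : Plane :=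
  !₂[multiplier (fun ξ => -(-(Complex.I * ξ 1)) * ((‖ξ‖ ^ (-3 + β) : ℝ) : ℂ)
        * (Complex.I * ξ 0)) f x,
     multiplier (fun ξ => -(Complex.I * ξ 0) * ((‖ξ‖ ^ (-3 + β) : ℝ) : ℂ)
        * (Complex.I * ξ 0)) f x]

/-- The divergence of a (differentiable) planar vector field. -/
def divergence (w : Plane → Plane) (x : Plane) : ℝ :=
  ∑ i : Fin 2, fderiv ℝ w x (EuclideanSpace.single i 1) i

/-- `‖f‖_{L^∞(0,T; L^p(ℝ²))}`, as an element of `[0,∞]`. -/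
def normLinftyLp {F : Type*} [NormedAddCommGroup F] (T : ℝ) (p : ℝ≥0∞) (f : ℝ → Plane → F) :
    ℝ≥0∞ :=
  essSup (fun t => eLpNorm (f t) p volume) (volume.restrict (Ioo 0 T))

/-- `M = max (‖w‖_{L^∞(0,T; L²)}, ‖∇w‖_{L^∞(0,T; L^∞)})`. -/
def driftBound (T : ℝ) (w : ℝ → Plane → Plane) : ℝ≥0∞ :=
  max (normLinftyLp T 2 w) (normLinftyLp T ⊤ (fun t => fderiv ℝ (w t)))

/-- `f t` has only small shocks with parameter `δ`, uniformly for `t ∈ [0,T]`: the same `L` serves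
all times. -/
def OSSUniformly (δ : ℝ≥0∞) (T : ℝ) (f : ℝ → Plane → ℝ) : Prop :=
  ∃ L : ℝ, 0 < L ∧ ∀ t ∈ Icc 0 T, ∀ x y : Plane, ‖x - y‖ < L →
    ENNReal.ofReal |f t x - f t y| ≤ δ

/-- `θ` is a smooth, spatially decaying solution on `[0,T]` of
`∂ₜθ + u·∇θ + Λ^β θ = 0`, `u = w + v`, `v = -∇^⊥ Λ^(-3+β) ∂₁ θ`, `θ(0) = θ₀`.
The drift `w` may be merely bounded in time, so `θ` is Lipschitz in time and the equation holds for
almost every time, at every point. The decay (not rapid decay, which `Λ^β` does not preserve) is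
integrability of the derivatives of low order; it makes the Fourier integrals that define `Λ^β θ`
and `v` absolutely convergent. -/
structure IsSmoothSolution (β T : ℝ) (w : ℝ → Plane → Plane) (θ₀ : Plane → ℝ)
    (θ : ℝ → Plane → ℝ) : Prop where
  smooth : ∀ t ∈ Icc 0 T, ContDiff ℝ ∞ (θ t)
  decay : ∃ K : ℝ≥0, ∀ t ∈ Icc 0 T, ∀ k ≤ 4,
    eLpNorm (iteratedFDeriv ℝ k (θ t)) 1 volume ≤ K
  lipschitz_time : ∃ K : ℝ≥0, ∀ x : Plane, LipschitzOnWith K (fun t => θ t x) (Icc 0 T)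
  initial : θ 0 = θ₀
  equation : ∀ᵐ t ∂(volume.restrict (Ioo 0 T)), ∀ x : Plane, ∃ θt : ℝ,
    HasDerivAt (fun s => θ s x) θt t ∧
      θt + fderiv ℝ (θ t) x (w t x + inducedVelocity β (θ t) x) + fracLaplacian β (θ t) x = 0

end

end GeneralizedSQG

namespace GeneralizedSQG

noncomputable section

/-! The estimate is a maximum principle for the Hölder quotients (θ(x) − θ(y)) / |x − y|^a. At a
pair (x, y) where the quotient is maximal, the gradients at x and y coincide, point along x − y and
have length aN/|x − y| with N = θ(x) − θ(y). Hence only the velocity difference u(x) − u(y) enters.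
Translating the pair keeps the separation, so θ(x − z) − θ(y − z) ≤ N for every z.

Both Λ^β and the velocity are written as integrals over heat times s. By the translation inequality
the defect N − (e^{sΔ}θ(x) − e^{sΔ}θ(y)) is nonnegative; its integral against s^(−1−β/2) is the
dissipation D. The second derivatives of the heat kernel have mean zero and are dominated by 1/s
times the kernel at time 2s. So heat times s ≤ ρ² contribute at most a multiple of ρD to the
velocity difference, while later times are controlled by a Hölder bound with constant Q and exponent
α and contribute a multiple of |x − y| Q ρ^(α−β) (`abs_multiplier_riesz_sub_le`). Conversely D ≥
(N/β) r^(−β) as soon as smoothing has halved the difference by time r² (`le_dissipation`). Together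
these give the differential inequality `IsHolderContact.deriv_le`.

The inequality is used twice. The velocity has order β − 1 in θ, so the equation is critical for the
sup norm. In `exists_holder_bound` the factor a = α in the gradient, chosen small in terms of the
sup norm of θ₀, makes the critical term smaller than the dissipation. In `exists_lipschitz_bound`
that Hölder bound makes the velocity subcritical: for large slopes γ the far part of the velocity
grows like γ^(β−α), against γ^β for the dissipation. There a stays below 1, so that maxima occur at
a positive distance, and a → 1 at the end with a constant independent of a. -/

/-! ### Maximum principle for suprema of equi-Lipschitz families -/

/-- Maximum principle: a supremum of equi-Lipschitz functions that is, at almost every time at which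
it exceeds `s₀`, attained by a member with nonpositive derivative, never exceeds `s₀`. -/
theorem le_of_deriv_nonpos_at_sup {ι : Type*} {F : ι → ℝ → ℝ} {K : ℝ≥0} {T s₀ : ℝ}
    (hlip : ∀ i, LipschitzOnWith K (F i) (Icc 0 T))
    (hbdd : ∀ t ∈ Icc 0 T, BddAbove (range fun i => F i t))
    (h0 : ∀ i, F i 0 ≤ s₀)
    (hev : ∀ᵐ t ∂(volume.restrict (Ioo 0 T)), ∀ s, s₀ < s → IsLUB (range fun i => F i t) s →
      ∃ i, F i t = s ∧ ∃ d ≤ 0, HasDerivAt (F i) d t) :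
    ∀ t ∈ Icc 0 T, ∀ i, F i t ≤ s₀ := by
  intro t₁ ht₁ i₀
  have : Nonempty ι := ⟨i₀⟩
  set S : ℝ → ℝ := fun t => ⨆ i, F i t with hS
  have hle : ∀ t ∈ Icc 0 T, ∀ i, F i t ≤ S t := fun t ht i => le_ciSup (hbdd t ht) i
  have hSlip : LipschitzOnWith K S (Icc 0 T) := by
    refine LipschitzOnWith.of_dist_le_mul fun t ht t' ht' => ?_
    have key : ∀ a ∈ Icc 0 T, ∀ b ∈ Icc 0 T, S a ≤ S b + K * dist a b := by
      intro a ha b hb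
      refine ciSup_le fun i => ?_
      have h1 := (hlip i).dist_le_mul a ha b hb
      rw [Real.dist_eq] at h1
      have h2 := le_abs_self (F i a - F i b)
      have h3 := hle b hb i
      linarith
    rw [Real.dist_eq, abs_le]
    have h1 := key t ht t' ht'
    have h2 := key t' ht' t ht
    rw [dist_comm] at h2
    constructor <;> linarith
  refine (hle t₁ ht₁ i₀).trans ?_
  by_contra! hgt
  -- The last time before `t₁` at which the supremum is at most `s₀`; after it the hypothesis on
  -- derivatives is available up to `t₁`.
  set A : Set ℝ := {t | t ∈ Icc 0 t₁ ∧ S t ≤ s₀} with hA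
  have hsub : Icc 0 t₁ ⊆ Icc 0 T := Icc_subset_Icc le_rfl ht₁.2
  have hAc : IsClosed A := by
    have hc : ContinuousOn S (Icc 0 t₁) := hSlip.continuousOn.mono hsub
    exact hc.preimage_isClosed_of_isClosed isClosed_Icc isClosed_Iic
  have hAcomp : IsCompact A := isCompact_Icc.of_isClosed_subset hAc fun t ht => ht.1
  have hAne : A.Nonempty := ⟨0, ⟨le_rfl, ht₁.1⟩, ciSup_le h0⟩
  obtain ⟨ht₀I, ht₀⟩ : sSup A ∈ A := hAcomp.sSup_mem hAne
  set t₀ := sSup A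
  have hout : ∀ t ∈ Ioc t₀ t₁, s₀ < S t := by
    intro t ht
    by_contra! hle'
    have : t ∈ A := ⟨⟨ht₀I.1.trans ht.1.le, ht.2⟩, hle'⟩
    exact absurd (le_csSup hAcomp.bddAbove this) (not_le.2 ht.1)
  have huIcc : uIcc t₀ t₁ ⊆ Icc 0 T := by
    rw [uIcc_of_le ht₀I.2]
    exact Icc_subset_Icc ht₀I.1 ht₁.2
  -- A Lipschitz function is absolutely continuous, so a sign of the derivative almost everywhere
  -- suffices.
  have hFTC := (hSlip.mono huIcc).absolutelyContinuousOnInterval.integral_deriv_eq_sub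
  have hneg : ∫ t in t₀..t₁, deriv S t ≤ 0 := by
    rw [intervalIntegral.integral_of_le ht₀I.2, integral_Ioc_eq_integral_Ioo]
    refine integral_nonpos_of_ae ?_
    have hsub' : Ioo t₀ t₁ ⊆ Ioo 0 T := Ioo_subset_Ioo ht₀I.1 ht₁.2
    have h1 := ae_restrict_of_ae_restrict_of_subset hsub' hev
    filter_upwards [h1, ae_restrict_mem measurableSet_Ioo] with t ht htI
    simp only [Pi.zero_apply]
    by_cases hd : DifferentiableAt ℝ S t
    swap
    · rw [deriv_zero_of_not_differentiableAt hd]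
    have htT : t ∈ Ioo 0 T := hsub' htI
    have htT' : t ∈ Icc 0 T := Ioo_subset_Icc_self htT
    obtain ⟨i, hi, d, hd0, hid⟩ := ht (S t) (hout t ⟨htI.1, htI.2.le⟩)
      (isLUB_ciSup (hbdd t htT'))
    -- `S` lies above `F i` and touches it at `t`, so the two derivatives agree.
    have hmin : IsLocalMin (fun r => S r - F i r) t := by
      filter_upwards [Icc_mem_nhds htT.1 htT.2] with r hr
      rw [hi, sub_self]
      exact sub_nonneg.2 (hle r hr i)
    have := hmin.hasDerivAt_eq_zero (hd.hasDerivAt.sub hid)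
    linarith
  linarith

/-! ### The heat kernel, its derivatives and Gaussian bounds -/

/-- The heat kernel of the plane. -/
def heatKernel (s : ℝ) (z : Plane) : ℝ := (4 * Real.pi * s)⁻¹ * Real.exp (-‖z‖ ^ 2 / (4 * s))

/-- The gradient of the heat kernel. -/
def heatGrad (s : ℝ) (z : Plane) : Plane →L[ℝ] ℝ := (-(heatKernel s z / (2 * s))) • innerSL ℝ z

/-- The ratio of the second derivative `∂ᵢ∂ⱼ` of the heat kernel to the heat kernel. -/
def heatPoly (i j : Fin 2) (s : ℝ) (z : Plane) : ℝ :=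
  z i * z j / (4 * s ^ 2) - (if i = j then 1 else 0) / (2 * s)

/-- The second derivative `∂ᵢ∂ⱼ` of the heat kernel. -/
def heatHess (i j : Fin 2) (s : ℝ) (z : Plane) : ℝ := heatPoly i j s z * heatKernel s z

/-- The gradient of the second derivative `∂ᵢ∂ⱼ` of the heat kernel. -/
def heatHessGrad (i j : Fin 2) (s : ℝ) (z : Plane) : Plane →L[ℝ] ℝ :=
  heatPoly i j s z • heatGrad s z + heatKernel s z •
    ((4 * s ^ 2)⁻¹ • (z i • (EuclideanSpace.proj j : Plane →L[ℝ] ℝ) +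
      z j • (EuclideanSpace.proj i : Plane →L[ℝ] ℝ)))

theorem heatKernel_pos {s : ℝ} (hs : 0 < s) (z : Plane) : 0 < heatKernel s z := by
  unfold heatKernel; positivity

theorem heatKernel_neg (s : ℝ) (z : Plane) : heatKernel s (-z) = heatKernel s z := by
  simp [heatKernel]

theorem heatGrad_neg (s : ℝ) (z : Plane) : heatGrad s (-z) = -heatGrad s z := by
  simp [heatGrad, heatKernel_neg]

theorem heatPoly_neg (i j : Fin 2) (s : ℝ) (z : Plane) : heatPoly i j s (-z) = heatPoly i j s z := by
  simp [heatPoly]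

theorem heatHessGrad_neg (i j : Fin 2) (s : ℝ) (z : Plane) :
    heatHessGrad i j s (-z) = -heatHessGrad i j s z := by
  ext v
  simp [heatHessGrad, heatPoly_neg, heatKernel_neg, heatGrad_neg]
  ring

theorem hasFDerivAt_heatKernel (s : ℝ) (z : Plane) :
    HasFDerivAt (heatKernel s) (heatGrad s z) z := by
  have h1 : HasFDerivAt (fun z : Plane => ‖z‖ ^ 2) (2 • innerSL ℝ z) z :=
    (hasStrictFDerivAt_norm_sq z).hasFDerivAt
  have h2 := ((h1.neg.mul_const ((4 * s)⁻¹)).exp).const_mul (4 * Real.pi * s)⁻¹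
  refine (h2.congr_fderiv ?_).congr_of_eventuallyEq ?_
  · ext v
    simp [heatGrad, heatKernel]
    rcases eq_or_ne s 0 with rfl | hs
    · simp
    · field_simp
      ring
  · filter_upwards with y
    simp [heatKernel, div_eq_mul_inv]

theorem hasFDerivAt_heatPoly (i j : Fin 2) (s : ℝ) (z : Plane) :
    HasFDerivAt (heatPoly i j s) ((4 * s ^ 2)⁻¹ • (z i • (EuclideanSpace.proj j : Plane →L[ℝ] ℝ) +
      z j • (EuclideanSpace.proj i : Plane →L[ℝ] ℝ))) z := by
  have hi : HasFDerivAt (fun z : Plane => z i) (EuclideanSpace.proj i : Plane →L[ℝ] ℝ) z :=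
    (EuclideanSpace.proj i : Plane →L[ℝ] ℝ).hasFDerivAt
  have hj : HasFDerivAt (fun z : Plane => z j) (EuclideanSpace.proj j : Plane →L[ℝ] ℝ) z :=
    (EuclideanSpace.proj j : Plane →L[ℝ] ℝ).hasFDerivAt
  exact ((hi.mul hj).mul_const ((4 * s ^ 2)⁻¹)).sub_const _

theorem hasFDerivAt_heatHess (i j : Fin 2) (s : ℝ) (z : Plane) :
    HasFDerivAt (heatHess i j s) (heatHessGrad i j s z) z :=
  (hasFDerivAt_heatPoly i j s z).mul (hasFDerivAt_heatKernel s z)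

theorem continuous_heatKernel (s : ℝ) : Continuous (heatKernel s) :=
  continuous_iff_continuousAt.2 fun z => (hasFDerivAt_heatKernel s z).continuousAt

theorem continuous_heatHess (i j : Fin 2) (s : ℝ) : Continuous (heatHess i j s) :=
  continuous_iff_continuousAt.2 fun z => (hasFDerivAt_heatHess i j s z).continuousAt

theorem continuous_heatPoly (i j : Fin 2) (s : ℝ) : Continuous (heatPoly i j s) :=
  continuous_iff_continuousAt.2 fun z => (hasFDerivAt_heatPoly i j s z).continuousAt

theorem continuous_heatGrad (s : ℝ) : Continuous (heatGrad s) := by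
  have := continuous_heatKernel s
  unfold heatGrad
  fun_prop

theorem continuous_heatHessGrad (i j : Fin 2) (s : ℝ) : Continuous (heatHessGrad i j s) := by
  have := continuous_heatKernel s
  have := continuous_heatGrad s
  have := continuous_heatPoly i j s
  unfold heatHessGrad
  fun_prop

theorem integral_heatKernel {s : ℝ} (hs : 0 < s) : ∫ z, heatKernel s z = 1 := by
  have h := GaussianFourier.integral_rexp_neg_mul_sq_norm (V := Plane) (b := (4 * s)⁻¹)
    (by positivity)
  have h2 : ∀ z : Plane, heatKernel s z =
      (4 * Real.pi * s)⁻¹ * Real.exp (-(4 * s)⁻¹ * ‖z‖ ^ 2) := by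
    intro z
    simp only [heatKernel]
    congr 2
    field_simp
  simp_rw [h2]
  rw [integral_const_mul, h]
  simp
  field_simp

theorem integrable_heatKernel {s : ℝ} (hs : 0 < s) : Integrable (heatKernel s) := by
  by_contra h
  have := integral_heatKernel hs
  rw [integral_undef h] at this
  exact zero_ne_one this

/-- Doubling the time halves the Gaussian exponent; the spare factor exp(q²/8) with q = |z|/√s
absorbs the polynomial. The constant is 1024 from that step, times 2 from the prefactor of the
kernel. -/
theorem heatKernel_absorb {s : ℝ} (hs : 0 < s) (z : Plane) :
    (1 + ‖z‖ / √s) ^ 4 * heatKernel s z ≤ 2048 * heatKernel (2 * s) z := by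
  set q := ‖z‖ / √s with hq
  have hq0 : 0 ≤ q := by positivity
  have hz : ‖z‖ ^ 2 = q ^ 2 * s := by
    rw [hq, div_pow, Real.sq_sqrt hs.le]; field_simp
  have h1 : (1 + q) ^ 2 ≤ 32 * Real.exp (q ^ 2 / 16) := by
    have := Real.add_one_le_exp (q ^ 2 / 16)
    nlinarith [sq_nonneg (q - 1)]
  have h2 : (1 + q) ^ 4 ≤ 1024 * Real.exp (q ^ 2 / 8) := by
    calc (1 + q) ^ 4 = ((1 + q) ^ 2) ^ 2 := by ring
      _ ≤ (32 * Real.exp (q ^ 2 / 16)) ^ 2 := by gcongr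
      _ = 1024 * (Real.exp (q ^ 2 / 16) * Real.exp (q ^ 2 / 16)) := by ring
      _ = _ := by rw [← Real.exp_add]; ring_nf
  have h3 : -‖z‖ ^ 2 / (4 * s) = -(q ^ 2 / 4) := by rw [hz]; field_simp
  have h4 : -‖z‖ ^ 2 / (4 * (2 * s)) = -(q ^ 2 / 8) := by rw [hz]; field_simp; ring
  have h5 : Real.exp (-(q ^ 2 / 8)) = Real.exp (q ^ 2 / 8) * Real.exp (-(q ^ 2 / 4)) := by
    rw [← Real.exp_add]; ring_nf
  unfold heatKernel
  rw [h3, h4, h5]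
  calc (1 + q) ^ 4 * ((4 * Real.pi * s)⁻¹ * Real.exp (-(q ^ 2 / 4)))
      ≤ (1024 * Real.exp (q ^ 2 / 8)) * ((4 * Real.pi * s)⁻¹ * Real.exp (-(q ^ 2 / 4))) := by
        gcongr
    _ = _ := by field_simp; ring

theorem rpow_le_one_add {q α : ℝ} (hq : 0 ≤ q) (hα0 : 0 ≤ α) (hα1 : α ≤ 1) : q ^ α ≤ 1 + q :=
  calc q ^ α ≤ (1 + q) ^ α := Real.rpow_le_rpow hq (by linarith) hα0
    _ ≤ (1 + q) ^ (1 : ℝ) := Real.rpow_le_rpow_of_exponent_le (by linarith) hα1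
    _ = 1 + q := Real.rpow_one _

/-- A function bounded by a cubic polynomial times the heat kernel, with a further weight. -/
theorem mul_rpow_le_of_le_heatKernel {s α m A : ℝ} (hs : 0 < s) (hα0 : 0 ≤ α) (hα1 : α ≤ 1)
    {z : Plane} (h : A ≤ (√s)⁻¹ ^ m * ((1 + ‖z‖ / √s) ^ 3 * heatKernel s z)) :
    A * ‖z‖ ^ α ≤ 2048 * s ^ ((α - m) / 2) * heatKernel (2 * s) z := by
  have hσ : 0 < √s := Real.sqrt_pos.2 hs
  set q := ‖z‖ / √s with hq
  have hq0 : 0 ≤ q := by positivity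
  have hz : ‖z‖ ^ α = q ^ α * √s ^ α := by
    rw [← Real.mul_rpow hq0 hσ.le, hq, div_mul_cancel₀ _ hσ.ne']
  have hpow : (√s)⁻¹ ^ m * √s ^ α = s ^ ((α - m) / 2) := by
    rw [Real.inv_rpow hσ.le, ← Real.rpow_neg hσ.le, ← Real.rpow_add hσ, Real.sqrt_eq_rpow,
      ← Real.rpow_mul hs.le]
    congr 1; ring
  have hG := heatKernel_pos hs z
  calc A * ‖z‖ ^ α ≤ ((√s)⁻¹ ^ m * ((1 + q) ^ 3 * heatKernel s z)) * (q ^ α * √s ^ α) := by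
        rw [hz]; gcongr
    _ ≤ ((√s)⁻¹ ^ m * ((1 + q) ^ 3 * heatKernel s z)) * ((1 + q) * √s ^ α) := by
        have := rpow_le_one_add hq0 hα0 hα1
        gcongr
    _ = ((√s)⁻¹ ^ m * √s ^ α) * ((1 + q) ^ 4 * heatKernel s z) := by ring
    _ ≤ ((√s)⁻¹ ^ m * √s ^ α) * (2048 * heatKernel (2 * s) z) := by
        have := heatKernel_absorb hs z
        gcongr
    _ = _ := by rw [hpow]; ring

theorem norm_heatGrad_eq {s : ℝ} (hs : 0 < s) (z : Plane) :
    ‖heatGrad s z‖ = (√s)⁻¹ * (‖z‖ / √s / 2) * heatKernel s z := by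
  have hG := heatKernel_pos hs z
  have hσ : 0 < √s := Real.sqrt_pos.2 hs
  rw [heatGrad, norm_smul, innerSL_apply_norm, norm_neg, Real.norm_of_nonneg (by positivity)]
  nth_rewrite 2 [← Real.mul_self_sqrt hs.le]
  field_simp

theorem norm_heatGrad_mul_rpow_le {s α : ℝ} (hs : 0 < s) (hα0 : 0 ≤ α) (hα1 : α ≤ 1) (z : Plane) :
    ‖heatGrad s z‖ * ‖z‖ ^ α ≤ 2048 * s ^ ((α - 1) / 2) * heatKernel (2 * s) z := by
  refine mul_rpow_le_of_le_heatKernel hs hα0 hα1 ?_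
  have hG := heatKernel_pos hs z
  have hσ : 0 < √s := Real.sqrt_pos.2 hs
  rw [norm_heatGrad_eq hs, Real.rpow_one, mul_assoc]
  have hq0 : 0 ≤ ‖z‖ / √s := by positivity
  gcongr
  nlinarith [pow_nonneg hq0 2, pow_nonneg hq0 3]

theorem abs_apply_le (z : Plane) (i : Fin 2) : |z i| ≤ ‖z‖ := by
  simpa using PiLp.norm_apply_le z i

theorem abs_heatPoly_le (i j : Fin 2) {s : ℝ} (hs : 0 < s) (z : Plane) :
    |heatPoly i j s z| ≤ s⁻¹ * ((‖z‖ / √s) ^ 2 / 4 + 1 / 2) := by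
  have h1 : |z i * z j / (4 * s ^ 2)| ≤ ‖z‖ * ‖z‖ / (4 * s ^ 2) := by
    rw [abs_div, abs_mul, abs_of_pos (by positivity : 0 < 4 * s ^ 2)]
    gcongr <;> exact abs_apply_le _ _
  have h2 : |(if i = j then (1 : ℝ) else 0) / (2 * s)| ≤ 1 / (2 * s) := by
    rw [abs_div, abs_of_pos (by positivity : 0 < 2 * s)]
    gcongr
    split_ifs <;> simp
  calc _ ≤ _ := (abs_sub _ _).trans (add_le_add h1 h2)
    _ = _ := by
      rw [div_pow, Real.sq_sqrt hs.le]
      field_simp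

theorem abs_heatHess_le (i j : Fin 2) {s : ℝ} (hs : 0 < s) (z : Plane) :
    |heatHess i j s z| ≤ 2048 * s⁻¹ * heatKernel (2 * s) z := by
  have hG := heatKernel_pos hs z
  have hσ : 0 < √s := Real.sqrt_pos.2 hs
  have hq0 : 0 ≤ ‖z‖ / √s := by positivity
  have := mul_rpow_le_of_le_heatKernel (m := 2) (α := 0) (A := |heatHess i j s z|) (z := z) hs
    le_rfl zero_le_one ?_
  · rwa [Real.rpow_zero, mul_one, show ((0 : ℝ) - 2) / 2 = -1 by norm_num, Real.rpow_neg_one] at this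
  · rw [heatHess, abs_mul, abs_of_pos hG, Real.rpow_two, inv_pow, Real.sq_sqrt hs.le, ← mul_assoc]
    gcongr
    refine (abs_heatPoly_le i j hs z).trans ?_
    gcongr
    nlinarith [pow_nonneg hq0 2, pow_nonneg hq0 3]

theorem norm_heatHessGrad_le (i j : Fin 2) {s : ℝ} (hs : 0 < s) (z : Plane) :
    ‖heatHessGrad i j s z‖ ≤ (√s)⁻¹ ^ (3 : ℝ) * ((1 + ‖z‖ / √s) ^ 3 * heatKernel s z) := by
  have hG := heatKernel_pos hs z
  have hσ : 0 < √s := Real.sqrt_pos.2 hs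
  have hq0 : 0 ≤ ‖z‖ / √s := by positivity
  have hproj : ∀ k : Fin 2, ‖(EuclideanSpace.proj k : Plane →L[ℝ] ℝ)‖ ≤ 1 := fun k =>
    ContinuousLinearMap.opNorm_le_bound _ zero_le_one fun v => by
      simpa using PiLp.norm_apply_le v k
  have h1 : ‖heatPoly i j s z • heatGrad s z‖ ≤ (s⁻¹ * ((‖z‖ / √s) ^ 2 / 4 + 1 / 2)) *
      ((√s)⁻¹ * (‖z‖ / √s / 2) * heatKernel s z) := by
    rw [norm_smul, norm_heatGrad_eq hs, Real.norm_eq_abs]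
    gcongr
    exact abs_heatPoly_le i j hs z
  have h2 : ‖heatKernel s z • ((4 * s ^ 2)⁻¹ • (z i • (EuclideanSpace.proj j : Plane →L[ℝ] ℝ) +
      z j • (EuclideanSpace.proj i : Plane →L[ℝ] ℝ)))‖ ≤
      heatKernel s z * ((4 * s ^ 2)⁻¹ * (‖z‖ * 1 + ‖z‖ * 1)) := by
    rw [norm_smul, norm_smul, Real.norm_of_nonneg hG.le, Real.norm_of_nonneg (by positivity)]
    gcongr
    refine (norm_add_le _ _).trans ?_
    rw [norm_smul, norm_smul, Real.norm_eq_abs, Real.norm_eq_abs]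
    gcongr
    · exact abs_apply_le _ _
    · exact hproj _
    · exact abs_apply_le _ _
    · exact hproj _
  refine (norm_add_le _ _).trans ((add_le_add h1 h2).trans ?_)
  have h3 : (√s)⁻¹ ^ (3 : ℝ) = s⁻¹ * (√s)⁻¹ := by
    rw [show (3 : ℝ) = ((3 : ℕ) : ℝ) by norm_num, Real.rpow_natCast, pow_succ, inv_pow,
      Real.sq_sqrt hs.le]
  have h4 : heatKernel s z * ((4 * s ^ 2)⁻¹ * (‖z‖ * 1 + ‖z‖ * 1)) =
      s⁻¹ * (√s)⁻¹ * ((‖z‖ / √s / 2) * heatKernel s z) := by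
    have : s⁻¹ * (√s)⁻¹ * (‖z‖ / √s / 2) = s⁻¹ * (√s * √s)⁻¹ * ‖z‖ / 2 := by
      field_simp
    rw [← mul_assoc (s⁻¹ * _), this, Real.mul_self_sqrt hs.le]
    field_simp
    ring
  rw [h3, h4]
  calc _ = s⁻¹ * (√s)⁻¹ * ((((‖z‖ / √s) ^ 2 / 4 + 1 / 2) * (‖z‖ / √s / 2) + ‖z‖ / √s / 2) *
        heatKernel s z) := by ring
    _ ≤ _ := by
      gcongr
      nlinarith [pow_nonneg hq0 2, pow_nonneg hq0 3]

theorem norm_heatHessGrad_mul_rpow_le (i j : Fin 2) {s α : ℝ} (hs : 0 < s) (hα0 : 0 ≤ α)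
    (hα1 : α ≤ 1) (z : Plane) :
    ‖heatHessGrad i j s z‖ * ‖z‖ ^ α ≤ 2048 * s ^ ((α - 3) / 2) * heatKernel (2 * s) z :=
  mul_rpow_le_of_le_heatKernel hs hα0 hα1 (norm_heatHessGrad_le i j hs z)

/-! ### Fourier transforms of the heat kernel and its second derivatives -/

theorem fourier_heatKernel {s : ℝ} (hs : 0 < s) (ξ : Plane) :
    𝓕 (fun z : Plane => (heatKernel s z : ℂ)) ξ =
      ((Real.exp (-s * ‖(2 * Real.pi) • ξ‖ ^ 2) : ℝ) : ℂ) := by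
  have h := fourier_gaussian_innerProductSpace (V := Plane) (b := (((4 * s)⁻¹ : ℝ) : ℂ))
    (by rw [Complex.ofReal_re]; positivity) ξ
  have h2 : (fun z : Plane => (heatKernel s z : ℂ)) =
      (((4 * Real.pi * s)⁻¹ : ℝ) : ℂ) • fun z : Plane =>
        Complex.exp (-(((4 * s)⁻¹ : ℝ) : ℂ) * ‖z‖ ^ 2) := by
    ext z
    simp only [heatKernel, Pi.smul_apply, smul_eq_mul]
    push_cast
    congr 2
    field_simp
  rw [h2, Real.fourier_eq]
  simp only [Pi.smul_apply]
  simp_rw [smul_comm _ (((4 * Real.pi * s)⁻¹ : ℝ) : ℂ)]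
  rw [integral_smul]
  rw [Real.fourier_eq] at h
  rw [h]
  have hs' : (s : ℂ) ≠ 0 := by exact_mod_cast hs.ne'
  have hpi : (Real.pi : ℂ) ≠ 0 := by exact_mod_cast Real.pi_ne_zero
  have hfin : (Module.finrank ℝ Plane : ℂ) / 2 = 1 := by simp
  rw [hfin, Complex.cpow_one, norm_smul, Real.norm_of_nonneg (by positivity), smul_eq_mul]
  push_cast
  rw [← mul_assoc, show (4 * (Real.pi : ℂ) * s)⁻¹ * (Real.pi / (4 * (s : ℂ))⁻¹) = 1 by field_simp,
    one_mul]
  congr 1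
  field_simp
  ring

theorem fourier_directional_deriv {g : Plane → ℝ} {g' : Plane → Plane →L[ℝ] ℝ}
    (hg : ∀ z, HasFDerivAt g (g' z) z) (hgi : Integrable g) (hgi' : Integrable g') (v ξ : Plane) :
    𝓕 (fun z => ((g' z v : ℝ) : ℂ)) ξ =
      2 * Real.pi * Complex.I * (inner ℝ ξ v : ℝ) * 𝓕 (fun z => (g z : ℂ)) ξ := by
  have hd : ∀ z, HasFDerivAt (fun z => (g z : ℂ)) (Complex.ofRealCLM.comp (g' z)) z := fun z =>
    Complex.ofRealCLM.hasFDerivAt.comp z (hg z)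
  have hfd : fderiv ℝ (fun z => (g z : ℂ)) = fun z => Complex.ofRealCLM.comp (g' z) :=
    funext fun z => (hd z).fderiv
  have hi : Integrable (fderiv ℝ (fun z => (g z : ℂ))) := by
    rw [hfd]
    exact (ContinuousLinearMap.compL ℝ Plane ℝ ℂ Complex.ofRealCLM).integrable_comp hgi'
  have h := congrFun (Real.fourier_fderiv hgi.ofReal (fun z => (hd z).differentiableAt) hi) ξ
  have h2 := congrArg (fun A : Plane →L[ℝ] ℂ => A v) h
  rw [Real.fourier_continuousLinearMap_apply (F := Plane) (v := ξ) (a := v) hi] at h2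
  simp [hfd] at h2
  rw [h2, innerSL_apply_apply]
  ring

theorem heatGrad_single (s : ℝ) (j : Fin 2) (z : Plane) :
    heatGrad s z (EuclideanSpace.single j 1) = -(z j / (2 * s)) * heatKernel s z := by
  simp [heatGrad, EuclideanSpace.inner_single_right]
  ring

theorem integrable_of_mul_heatKernel {E : Type*} [NormedAddCommGroup E] {g : Plane → E}
    (hg : Continuous g) {s A : ℝ} (hs : 0 < s) (h : ∀ z, ‖g z‖ ≤ A * heatKernel s z) :
    Integrable g :=
  ((integrable_heatKernel hs).const_mul A).mono' hg.aestronglyMeasurable (.of_forall h)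

theorem norm_heatGrad_le {s : ℝ} (hs : 0 < s) (z : Plane) :
    ‖heatGrad s z‖ ≤ 2048 * s ^ (((0 : ℝ) - 1) / 2) * heatKernel (2 * s) z := by
  simpa using norm_heatGrad_mul_rpow_le hs le_rfl zero_le_one z

theorem integrable_heatGrad {s : ℝ} (hs : 0 < s) : Integrable (heatGrad s) :=
  integrable_of_mul_heatKernel (continuous_heatGrad s) (by positivity) (norm_heatGrad_le hs)

theorem integrable_heatHess (i j : Fin 2) {s : ℝ} (hs : 0 < s) : Integrable (heatHess i j s) :=
  integrable_of_mul_heatKernel (continuous_heatHess i j s) (by positivity)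
    (abs_heatHess_le i j hs)

theorem hasFDerivAt_heatGrad_single (s : ℝ) (j : Fin 2) (z : Plane) :
    HasFDerivAt (fun z => heatGrad s z (EuclideanSpace.single j 1))
      ((-(z j / (2 * s))) • heatGrad s z +
        heatKernel s z • (-(2 * s)⁻¹ • (EuclideanSpace.proj j : Plane →L[ℝ] ℝ))) z := by
  simp_rw [heatGrad_single]
  have hj : HasFDerivAt (fun z : Plane => -(z j / (2 * s)))
      (-(2 * s)⁻¹ • (EuclideanSpace.proj j : Plane →L[ℝ] ℝ)) z := by
    have := ((EuclideanSpace.proj j : Plane →L[ℝ] ℝ).hasFDerivAt (x := z)).mul_const (-(2 * s)⁻¹)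
    refine this.congr_of_eventuallyEq (.of_forall fun y => ?_)
    simp [div_eq_mul_inv]
  exact hj.mul (hasFDerivAt_heatKernel s z)

theorem fourier_heatHess (i j : Fin 2) {s : ℝ} (hs : 0 < s) (ξ : Plane) :
    𝓕 (fun z : Plane => (heatHess i j s z : ℂ)) ξ =
      ((-(((2 * Real.pi) • ξ) i * ((2 * Real.pi) • ξ) j *
        Real.exp (-s * ‖(2 * Real.pi) • ξ‖ ^ 2)) : ℝ) : ℂ) := by
  have hcont := continuous_heatKernel s
  have hcont' := continuous_heatGrad s
  have hp : ∀ k : Fin 2, ‖(EuclideanSpace.proj k : Plane →L[ℝ] ℝ)‖ ≤ 1 := fun k =>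
    ContinuousLinearMap.opNorm_le_bound _ zero_le_one fun v => by
      simpa using PiLp.norm_apply_le v k
  have h1 := fourier_directional_deriv (hasFDerivAt_heatKernel s) (integrable_heatKernel hs)
    (integrable_heatGrad hs) (EuclideanSpace.single j 1) ξ
  have h2 := fourier_directional_deriv (hasFDerivAt_heatGrad_single s j)
    ((ContinuousLinearMap.apply ℝ ℝ (EuclideanSpace.single j (1 : ℝ) : Plane)).integrable_comp
      (integrable_heatGrad hs)) ?_ (EuclideanSpace.single i 1) ξ
  · rw [h1, fourier_heatKernel hs] at h2
    have h3 : (fun z : Plane => (heatHess i j s z : ℂ)) = fun z : Plane =>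
        ((((-(z j / (2 * s))) • heatGrad s z + heatKernel s z •
          (-(2 * s)⁻¹ • (EuclideanSpace.proj j : Plane →L[ℝ] ℝ)))
            (EuclideanSpace.single i 1) : ℝ) : ℂ) := by
      ext z
      congr 1
      simp only [add_apply, smul_apply, heatGrad_single, smul_eq_mul, PiLp.proj_apply,
        PiLp.single_apply, heatHess, heatPoly]
      by_cases hij : i = j
      · simp [hij]; field_simp; ring
      · simp [hij, Ne.symm hij, eq_comm]; field_simp; ring
    rw [h3, h2]
    simp [EuclideanSpace.inner_single_right]
    ring_nf
    simp
  · refine Integrable.add (f := fun z => (-(z j / (2 * s))) • heatGrad s z) ?_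
      ((integrable_heatKernel hs).smul_const _)
    refine integrable_of_mul_heatKernel (s := 2 * s) (A := 2048 * s⁻¹) (by fun_prop)
      (by positivity) fun z => ?_
    have hG := heatKernel_pos hs z
    have hσ : 0 < √s := Real.sqrt_pos.2 hs
    have hq0 : 0 ≤ ‖z‖ / √s := by positivity
    have := mul_rpow_le_of_le_heatKernel (m := 2) (α := 0) (z := z) hs le_rfl zero_le_one
      (A := ‖(-(z j / (2 * s))) • heatGrad s z‖) ?_
    · rwa [Real.rpow_zero, mul_one, show ((0 : ℝ) - 2) / 2 = -1 by norm_num,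
        Real.rpow_neg_one] at this
    · rw [norm_smul, norm_heatGrad_eq hs, Real.norm_eq_abs, abs_neg, abs_div,
        abs_of_pos (by positivity : 0 < 2 * s), Real.rpow_two]
      calc |z j| / (2 * s) * ((√s)⁻¹ * (‖z‖ / √s / 2) * heatKernel s z)
          ≤ ‖z‖ / (2 * (√s * √s)) * ((√s)⁻¹ * (‖z‖ / √s / 2) * heatKernel s z) := by
            rw [Real.mul_self_sqrt hs.le]
            gcongr
            exact abs_apply_le z j
        _ = (√s)⁻¹ ^ 2 * (((‖z‖ / √s) ^ 2 / 4) * heatKernel s z) := by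
            field_simp
            ring
        _ ≤ _ := by
            gcongr
            nlinarith [pow_nonneg hq0 2, pow_nonneg hq0 3]

/-- The integral is the Fourier transform at frequency zero, where the symbol vanishes. This
cancellation allows a constant to be subtracted from the convolved function. -/
theorem integral_heatHess (i j : Fin 2) {s : ℝ} (hs : 0 < s) : ∫ z, heatHess i j s z = 0 := by
  have h := fourier_heatHess i j hs 0
  rw [Real.fourier_eq] at h
  simp at h
  rw [integral_complex_ofReal] at h
  exact_mod_cast h

/-! ### Convolutions and smoothing of Hölder functions -/

/-- Convolution of real functions on the plane. -/
def conv (k f : Plane → ℝ) (x : Plane) : ℝ := ∫ y, k (x - y) * f y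

theorem conv_eq (k f : Plane → ℝ) (x : Plane) : conv k f x = ∫ z, k z * f (x - z) := by
  rw [conv, ← integral_sub_left_eq_self _ volume x]
  simp

/-- Self-adjointness of the Fourier transform moves it from `k` onto the modulated transform of `f`,
and inversion turns the latter into `f (x - z)`. Only the transform of `f` has to be integrable, not
that of `k`. -/
theorem fourierInv_fourier_mul_fourier {k f : Plane → ℝ} (hk : Integrable k) (hf : Integrable f)
    (hfc : Continuous f) (hff : Integrable (𝓕 fun y => (f y : ℂ))) (x : Plane) :
    𝓕⁻ (fun ξ => 𝓕 (fun z => (k z : ℂ)) ξ * 𝓕 (fun y => (f y : ℂ)) ξ) x = (conv k f x : ℂ) := by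
  have hL : Continuous fun p : Plane × Plane => (innerₗ Plane) p.1 p.2 := by
    simp only [innerₗ_apply_apply]; fun_prop
  have hg : Integrable fun ξ : Plane =>
      Real.fourierChar (inner ℝ ξ x) • 𝓕 (fun y => (f y : ℂ)) ξ := by
    have := (Real.fourierIntegral_convergent_iff (f := 𝓕 fun y => (f y : ℂ)) (-x)).2 hff
    simpa using this
  have h := VectorFourier.integral_fourierIntegral_smul_eq_flip (L := innerₗ Plane) (μ := volume)
    (ν := volume) Real.continuous_fourierChar hL hk.ofReal (𝕜 := ℝ) hg
  have hinv : ∀ z, VectorFourier.fourierIntegral Real.fourierChar volume (innerₗ Plane).flip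
      (fun ξ : Plane => Real.fourierChar (inner ℝ ξ x) • 𝓕 (fun y => (f y : ℂ)) ξ) z =
      (f (x - z) : ℂ) := by
    intro z
    have h1 := congrFun (Continuous.fourierInv_fourier_eq (f := fun y => (f y : ℂ))
      (by fun_prop) hf.ofReal hff) (x - z)
    rw [← h1, Real.fourierInv_eq, VectorFourier.fourierIntegral]
    congr 1
    ext ξ
    rw [smul_smul, ← AddChar.map_add_eq_mul]
    congr 2
    simp [inner_sub_right, real_inner_comm]
    ring
  simp_rw [hinv] at h
  rw [conv_eq, ← integral_complex_ofReal, Real.fourierInv_eq]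
  convert h using 2
  · ext ξ
    simp only [Real.fourier_eq, VectorFourier.fourierIntegral, innerₗ_apply_apply]
    rw [smul_eq_mul, mul_smul_comm]
    rfl
  · ext z; simp

theorem heatKernel_le {s : ℝ} (hs : 0 < s) (z : Plane) : heatKernel s z ≤ (4 * Real.pi * s)⁻¹ := by
  unfold heatKernel
  refine mul_le_of_le_one_right (by positivity) (Real.exp_le_one_iff.2 ?_)
  rw [neg_div]
  exact neg_nonpos.2 (by positivity)

theorem integral_eq_zero_of_odd {E : Type*} [NormedAddCommGroup E] [NormedSpace ℝ E]
    {g : Plane → E} (hodd : ∀ z, g (-z) = -g z) : ∫ z, g z = 0 := by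
  have h := integral_neg_eq_self g volume
  simp_rw [hodd, integral_neg] at h
  have h2 : (2 : ℝ) • ∫ z, g z = 0 := by
    rw [two_smul]
    nth_rewrite 1 [← h]
    simp
  simpa using h2

theorem hasFDerivAt_conv {k f : Plane → ℝ} {k' : Plane → Plane →L[ℝ] ℝ} {B B' : ℝ}
    (hk : ∀ z, HasFDerivAt k (k' z) z) (hk'c : Continuous k') (hB : ∀ z, |k z| ≤ B)
    (hB' : ∀ z, ‖k' z‖ ≤ B') (hf : Integrable f) (x : Plane) :
    HasFDerivAt (conv k f) (∫ y, f y • k' (x - y)) x := by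
  have hkc : Continuous k := continuous_iff_continuousAt.2 fun z => (hk z).continuousAt
  refine hasFDerivAt_integral_of_dominated_of_fderiv_le (s := univ)
    (F' := fun x y => f y • k' (x - y)) (bound := fun y => B' * ‖f y‖) Filter.univ_mem ?_ ?_ ?_ ?_ ?_ ?_
  · refine .of_forall fun x => ?_
    exact (hkc.comp (continuous_const.sub continuous_id)).aestronglyMeasurable.mul hf.1
  · exact hf.bdd_mul (hkc.comp (continuous_const.sub continuous_id)).aestronglyMeasurable
      (.of_forall fun y => hB (x - y))
  · exact hf.1.smul (hk'c.comp (continuous_const.sub continuous_id)).aestronglyMeasurable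
  · refine .of_forall fun y x _ => ?_
    rw [norm_smul, mul_comm]
    exact mul_le_mul_of_nonneg_right (hB' _) (norm_nonneg _)
  · exact hf.norm.const_mul _
  · refine .of_forall fun y x _ => ?_
    have h := (hk (x - y)).comp x ((hasFDerivAt_id x).sub_const y)
    exact h.mul_const (f y)

/-- The gradient of the convolution is bounded by A Q: an odd `k'` has mean zero, so `f x` can be
subtracted, and the Hölder factor |z|^α then meets the weight in `hw`. -/
theorem abs_conv_sub_le {k f : Plane → ℝ} {k' : Plane → Plane →L[ℝ] ℝ} {A B B' Q α s : ℝ}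
    (hk : ∀ z, HasFDerivAt k (k' z) z) (hk'c : Continuous k') (hB : ∀ z, |k z| ≤ B)
    (hB' : ∀ z, ‖k' z‖ ≤ B') (hodd : ∀ z, k' (-z) = -k' z) (hk'i : Integrable k')
    (hf : Integrable f) (hs : 0 < s) (hw : ∀ z, ‖k' z‖ * ‖z‖ ^ α ≤ A * heatKernel s z)
    (hQ0 : 0 ≤ Q) (hQ : ∀ x y, |f x - f y| ≤ Q * ‖x - y‖ ^ α) (x y : Plane) :
    |conv k f x - conv k f y| ≤ A * Q * ‖x - y‖ := by
  refine convex_univ.norm_image_sub_le_of_norm_hasFDerivWithin_le (f := conv k f) (C := A * Q)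
    (fun z _ => (hasFDerivAt_conv hk hk'c hB hB' hf z).hasFDerivWithinAt) (fun x _ => ?_)
    (mem_univ y) (mem_univ x)
  have h1 : ∫ y, f y • k' (x - y) = ∫ z, f (x - z) • k' z := by
    have h := (integral_sub_left_eq_self (fun y => f y • k' (x - y)) volume x).symm
    simp only [sub_sub_cancel] at h
    exact h
  have hi : Integrable fun z => f (x - z) • k' z := by
    have hfx : Integrable fun z => f (x - z) := hf.comp_sub_left x
    refine (hfx.norm.const_mul B').mono' (hfx.1.smul hk'i.1) (.of_forall fun z => ?_)
    rw [norm_smul, mul_comm]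
    exact mul_le_mul_of_nonneg_right (hB' _) (norm_nonneg _)
  have h2 : ∫ z, f (x - z) • k' z = ∫ z, (f (x - z) - f x) • k' z := by
    have h : ∀ z, (f (x - z) - f x) • k' z = f (x - z) • k' z - f x • k' z :=
      fun z => by ext v; simp [sub_mul]
    simp_rw [h]
    have hi' : Integrable fun z => f x • k' z := hk'i.smul (f x)
    rw [integral_sub hi hi', integral_smul, integral_eq_zero_of_odd hodd]
    simp
  rw [h1, h2]
  have h3 : ∀ z, ‖(f (x - z) - f x) • k' z‖ ≤ A * Q * heatKernel s z := by
    intro z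
    rw [norm_smul, Real.norm_eq_abs]
    have h := hQ (x - z) x
    rw [sub_sub_cancel_left, norm_neg] at h
    calc _ ≤ (Q * ‖z‖ ^ α) * ‖k' z‖ := by gcongr
      _ = Q * (‖k' z‖ * ‖z‖ ^ α) := by ring
      _ ≤ Q * (A * heatKernel s z) := by exact mul_le_mul_of_nonneg_left (hw z) hQ0
      _ = _ := by ring
  refine (norm_integral_le_of_norm_le ((integrable_heatKernel hs).const_mul _)
    (.of_forall h3)).trans_eq ?_
  rw [integral_const_mul, integral_heatKernel hs, mul_one]

theorem abs_conv_heatKernel_sub_le {f : Plane → ℝ} {Q α s : ℝ} (hf : Integrable f) (hs : 0 < s)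
    (hα0 : 0 ≤ α) (hα1 : α ≤ 1) (hQ0 : 0 ≤ Q) (hQ : ∀ x y, |f x - f y| ≤ Q * ‖x - y‖ ^ α)
    (x y : Plane) :
    |conv (heatKernel s) f x - conv (heatKernel s) f y| ≤
      2048 * s ^ ((α - 1) / 2) * Q * ‖x - y‖ := by
  refine abs_conv_sub_le (B := (4 * Real.pi * s)⁻¹)
    (B' := 2048 * s ^ (((0 : ℝ) - 1) / 2) * (4 * Real.pi * (2 * s))⁻¹)
    (hasFDerivAt_heatKernel s) (continuous_heatGrad s) (fun z => ?_) (fun z => (norm_heatGrad_le hs z).trans ?_) (heatGrad_neg s)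
    (integrable_heatGrad hs) hf (by positivity : 0 < 2 * s)
    (norm_heatGrad_mul_rpow_le hs hα0 hα1) hQ0 hQ x y
  · rw [abs_of_pos (heatKernel_pos hs z)]
    exact heatKernel_le hs z
  · gcongr
    exact heatKernel_le (by positivity) z

theorem abs_heatHess_le_const (i j : Fin 2) {s : ℝ} (hs : 0 < s) (z : Plane) :
    |heatHess i j s z| ≤ 2048 * s⁻¹ * (4 * Real.pi * (2 * s))⁻¹ := by
  refine (abs_heatHess_le i j hs z).trans ?_
  gcongr
  exact heatKernel_le (by positivity) z

theorem abs_conv_heatHess_sub_le (i j : Fin 2) {f : Plane → ℝ} {Q α s : ℝ} (hf : Integrable f)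
    (hs : 0 < s) (hα0 : 0 ≤ α) (hα1 : α ≤ 1) (hQ0 : 0 ≤ Q)
    (hQ : ∀ x y, |f x - f y| ≤ Q * ‖x - y‖ ^ α) (x y : Plane) :
    |conv (heatHess i j s) f x - conv (heatHess i j s) f y| ≤
      2048 * s ^ ((α - 3) / 2) * Q * ‖x - y‖ := by
  have h0 : ∀ z, ‖heatHessGrad i j s z‖ ≤
      2048 * s ^ (((0 : ℝ) - 3) / 2) * heatKernel (2 * s) z := fun z => by
    simpa using norm_heatHessGrad_mul_rpow_le i j hs le_rfl zero_le_one z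
  refine abs_conv_sub_le (B' := 2048 * s ^ (((0 : ℝ) - 3) / 2) * (4 * Real.pi * (2 * s))⁻¹)
    (hasFDerivAt_heatHess i j s) (continuous_heatHessGrad i j s)
    (abs_heatHess_le_const i j hs) (fun z => (h0 z).trans ?_) (heatHessGrad_neg i j s)
    (integrable_of_mul_heatKernel (continuous_heatHessGrad i j s) (by positivity) h0)
    hf (by positivity : 0 < 2 * s) (norm_heatHessGrad_mul_rpow_le i j hs hα0 hα1) hQ0 hQ x y
  gcongr
  exact heatKernel_le (by positivity) z

/-! ### The defect of a difference under the heat flow -/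

/-- The amount by which the heat flow decreases a difference `f x - f y = N`. -/
def defect (f : Plane → ℝ) (x y : Plane) (N s : ℝ) : ℝ :=
  N - (conv (heatKernel s) f x - conv (heatKernel s) f y)

theorem integrable_mul_comp_sub {k f : Plane → ℝ} {B : ℝ} (hk : Continuous k)
    (hB : ∀ z, |k z| ≤ B) (hf : Integrable f) (x : Plane) : Integrable fun z => k z * f (x - z) :=
  (hf.comp_sub_left x).bdd_mul hk.aestronglyMeasurable (.of_forall hB)

theorem abs_heatKernel_le {s : ℝ} (hs : 0 < s) (z : Plane) :
    |heatKernel s z| ≤ (4 * Real.pi * s)⁻¹ := by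
  rw [abs_of_pos (heatKernel_pos hs z)]
  exact heatKernel_le hs z

theorem integrable_defect {f : Plane → ℝ} (hf : Integrable f) {s : ℝ} (hs : 0 < s) (x y : Plane)
    (N : ℝ) : Integrable fun z => heatKernel s z * (N - (f (x - z) - f (y - z))) := by
  have hx := integrable_mul_comp_sub (continuous_heatKernel s) (abs_heatKernel_le hs) hf x
  have hy := integrable_mul_comp_sub (continuous_heatKernel s) (abs_heatKernel_le hs) hf y
  refine (((integrable_heatKernel hs).mul_const N).sub (hx.sub hy)).congr (.of_forall fun z => ?_)
  simp only [Pi.sub_apply]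
  ring

theorem defect_eq {f : Plane → ℝ} (hf : Integrable f) {s : ℝ} (hs : 0 < s) (x y : Plane) (N : ℝ) :
    defect f x y N s = ∫ z, heatKernel s z * (N - (f (x - z) - f (y - z))) := by
  have hx := integrable_mul_comp_sub (continuous_heatKernel s) (abs_heatKernel_le hs) hf x
  have hy := integrable_mul_comp_sub (continuous_heatKernel s) (abs_heatKernel_le hs) hf y
  have h : ∀ z, heatKernel s z * (N - (f (x - z) - f (y - z))) = heatKernel s z * N -
      (heatKernel s z * f (x - z) - heatKernel s z * f (y - z)) := fun z => by ring
  have hxy : Integrable fun z => heatKernel s z * f (x - z) - heatKernel s z * f (y - z) := hx.sub hy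
  simp_rw [h]
  rw [integral_sub ((integrable_heatKernel hs).mul_const N) hxy, integral_sub hx hy,
    integral_mul_const, integral_heatKernel hs, one_mul, defect, conv_eq, conv_eq]

theorem defect_nonneg {f : Plane → ℝ} (hf : Integrable f) {s : ℝ} (hs : 0 < s) {x y : Plane}
    {N : ℝ} (hN : ∀ z, f (x - z) - f (y - z) ≤ N) : 0 ≤ defect f x y N s := by
  rw [defect_eq hf hs]
  exact integral_nonneg fun z => mul_nonneg (heatKernel_pos hs z).le (sub_nonneg.2 (hN z))

/-- The mean of the kernel is zero, so N may be subtracted from the difference. What remains has a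
sign, hence replacing the kernel by its Gaussian majorant at time 2s yields exactly the defect at
that time. This is how the singular short-time part of the velocity is paid for by dissipation, with
no regularity of `f`. -/
theorem abs_conv_heatHess_sub_le_defect (i j : Fin 2) {f : Plane → ℝ} (hf : Integrable f) {s : ℝ}
    (hs : 0 < s) {x y : Plane} {N : ℝ} (hN : ∀ z, f (x - z) - f (y - z) ≤ N) :
    |conv (heatHess i j s) f x - conv (heatHess i j s) f y| ≤
      2048 * s⁻¹ * defect f x y N (2 * s) := by
  have hx := integrable_mul_comp_sub (continuous_heatHess i j s) (abs_heatHess_le_const i j hs) hf x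
  have hy := integrable_mul_comp_sub (continuous_heatHess i j s) (abs_heatHess_le_const i j hs) hf y
  have h1 : conv (heatHess i j s) f x - conv (heatHess i j s) f y =
      ∫ z, heatHess i j s z * ((f (x - z) - f (y - z)) - N) := by
    have h : ∀ z, heatHess i j s z * ((f (x - z) - f (y - z)) - N) =
      (heatHess i j s z * f (x - z) - heatHess i j s z * f (y - z)) - heatHess i j s z * N :=
      fun z => by ring
    have hxy : Integrable fun z =>
        heatHess i j s z * f (x - z) - heatHess i j s z * f (y - z) := hx.sub hy
    simp_rw [h]
    rw [integral_sub hxy ((integrable_heatHess i j hs).mul_const N), integral_sub hx hy,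
      integral_mul_const, integral_heatHess i j hs, conv_eq, conv_eq]
    simp
  have h2s : 0 < 2 * s := by positivity
  rw [h1, defect_eq hf h2s, ← integral_const_mul, ← Real.norm_eq_abs]
  refine norm_integral_le_of_norm_le ((integrable_defect hf h2s x y N).const_mul _)
    (.of_forall fun z => ?_)
  have h3 := sub_nonneg.2 (hN z)
  rw [norm_mul, Real.norm_eq_abs, Real.norm_eq_abs, abs_sub_comm, abs_of_nonneg h3, ← mul_assoc]
  gcongr
  exact abs_heatHess_le i j hs z

/-! ### Fourier multipliers as integrals over heat times -/

theorem integrable_rpow_norm_mul {p : ℝ} (hp : -1 ≤ p) (hp' : p ≤ 1) :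
    Integrable fun ξ : Plane => ‖ξ‖ ^ p * (1 + ‖ξ‖) ^ (-4 : ℝ) := by
  refine (integrable_fun_norm_addHaar (E := Plane) volume
    (f := fun y : ℝ => y ^ p * (1 + y) ^ (-4 : ℝ))).2 ?_
  have h1 : Integrable fun y : ℝ => (1 + ‖y‖) ^ (-2 : ℝ) := integrable_one_add_norm (by simp)
  refine h1.integrableOn.mono' ?_ ((ae_restrict_mem measurableSet_Ioi).mono fun y hy => ?_)
  · exact Measurable.aestronglyMeasurable (by fun_prop)
  · have hy' : 0 < y := hy
    rw [Real.norm_of_nonneg (by positivity), Real.norm_of_nonneg hy'.le]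
    simp only [finrank_euclideanSpace, Fintype.card_fin, smul_eq_mul]
    have h2 : y ^ (2 - 1) * (y ^ p * (1 + y) ^ (-4 : ℝ)) = y ^ (1 + p) * (1 + y) ^ (-4 : ℝ) := by
      rw [Real.rpow_add hy', Real.rpow_one]
      ring
    have h3 : y ^ (1 + p) ≤ (1 + y) ^ (2 : ℝ) :=
      (Real.rpow_le_rpow hy'.le (by linarith) (by linarith)).trans
        (Real.rpow_le_rpow_of_exponent_le (by linarith) (by linarith))
    calc _ = y ^ (1 + p) * (1 + y) ^ (-4 : ℝ) := h2
      _ ≤ (1 + y) ^ (2 : ℝ) * (1 + y) ^ (-4 : ℝ) := by gcongr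
      _ = _ := by
        rw [← Real.rpow_add (by positivity)]
        norm_num

/-- An integrable continuous function whose Fourier transform decays to order `4`. -/
structure FourierDecay (A : ℝ) (f : Plane → ℝ) : Prop where
  continuous : Continuous f
  integrable : Integrable f
  bound : ∀ ξ, ‖𝓕 (fun y => (f y : ℂ)) ξ‖ ≤ A * (1 + ‖ξ‖) ^ (-4 : ℝ)

namespace FourierDecay

variable {A : ℝ} {f : Plane → ℝ}

theorem continuous_fourier (hf : FourierDecay A f) : Continuous (𝓕 fun y => (f y : ℂ)) :=
  VectorFourier.fourierIntegral_continuous Real.continuous_fourierChar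
    (by exact continuous_inner) hf.integrable.ofReal

theorem integrable_rpow_mul (hf : FourierDecay A f) {p : ℝ} (hp : -1 ≤ p) (hp' : p ≤ 1) :
    Integrable fun ξ : Plane => ‖ξ‖ ^ p * ‖𝓕 (fun y => (f y : ℂ)) ξ‖ := by
  refine ((integrable_rpow_norm_mul hp hp').const_mul A).mono' ?_ (.of_forall fun ξ => ?_)
  · exact Measurable.aestronglyMeasurable
      ((by fun_prop : Measurable fun ξ : Plane => ‖ξ‖ ^ p).mul hf.continuous_fourier.norm.measurable)
  · rw [Real.norm_of_nonneg (by positivity)]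
    calc _ ≤ ‖ξ‖ ^ p * (A * (1 + ‖ξ‖) ^ (-4 : ℝ)) := by gcongr; exact hf.bound ξ
      _ = _ := by ring

theorem integrable_fourier (hf : FourierDecay A f) : Integrable (𝓕 fun y => (f y : ℂ)) := by
  refine (integrable_norm_iff hf.continuous_fourier.aestronglyMeasurable).1 ?_
  simpa using hf.integrable_rpow_mul (p := 0) (by norm_num) (by norm_num)

end FourierDecay

/-- Fubini for a symbol that is a superposition over s. The bound `hb`, together with the
fourth-order decay of the transform of `f`, gives absolute integrability in (s, ξ). Frequency zero
is a null set, so negative powers of |ζ| do no harm there. -/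
theorem multiplier_eq_integral {A C p : ℝ} {f : Plane → ℝ} (hf : FourierDecay A f) (hp : -1 ≤ p)
    (hp' : p ≤ 1) {m : Plane → ℝ} {Φ g : ℝ → Plane → ℝ} (hΦm : Measurable (Function.uncurry Φ))
    (hΦi : ∀ ζ ≠ 0, IntegrableOn (fun s => Φ s ζ) (Ioi 0))
    (hΦ : ∀ ζ ≠ 0, ∫ s in Ioi 0, Φ s ζ = m ζ)
    (hb : ∀ ζ ≠ 0, ∫ s in Ioi 0, |Φ s ζ| ≤ C * ‖ζ‖ ^ p)
    (hg : ∀ s > 0, ∀ x, 𝓕⁻ (fun ξ : Plane => (Φ s ((2 * Real.pi) • ξ) : ℂ) *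
      𝓕 (fun y => (f y : ℂ)) ξ) x = (g s x : ℂ)) (x : Plane) :
    IntegrableOn (fun s => g s x) (Ioi 0) ∧
      multiplier (fun ζ => (m ζ : ℂ)) f x = ∫ s in Ioi 0, g s x := by
  set H : ℝ → Plane → ℂ := fun s ξ => ((Real.fourierChar (inner ℝ ξ x) : Circle) : ℂ) *
    ((Φ s ((2 * Real.pi) • ξ) : ℂ) * 𝓕 (fun y => (f y : ℂ)) ξ) with hH
  have hnorm : ∀ s ξ, ‖H s ξ‖ = |Φ s ((2 * Real.pi) • ξ)| * ‖𝓕 (fun y => (f y : ℂ)) ξ‖ := by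
    intro s ξ
    simp only [hH, norm_mul, Complex.norm_real, Real.norm_eq_abs]
    rw [Circle.norm_coe, one_mul]
  have hne : ∀ᵐ ξ : Plane, ξ ≠ 0 := by
    simp [ae_iff]
  have hne' : ∀ ξ : Plane, ξ ≠ 0 → (2 * Real.pi) • ξ ≠ 0 := fun ξ h =>
    smul_ne_zero (by positivity) h
  have hmeas : AEStronglyMeasurable (Function.uncurry H)
      ((volume.restrict (Ioi 0)).prod (volume : Measure Plane)) := by
    refine Measurable.aestronglyMeasurable ?_
    have h0 : Measurable fun q : ℝ × Plane => (2 * Real.pi) • q.2 := by fun_prop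
    have h1 : Measurable fun q : ℝ × Plane => (Φ q.1 ((2 * Real.pi) • q.2) : ℂ) :=
      Complex.measurable_ofReal.comp (hΦm.comp (measurable_fst.prodMk h0))
    have h2 : Measurable fun q : ℝ × Plane => 𝓕 (fun y => (f y : ℂ)) q.2 :=
      hf.continuous_fourier.measurable.comp measurable_snd
    have h3 : Measurable fun q : ℝ × Plane => ((Real.fourierChar (inner ℝ q.2 x) : Circle) : ℂ) := by
      refine Continuous.measurable ?_
      have := Real.continuous_fourierChar
      fun_prop
    exact h3.mul (h1.mul h2)
  have hint : Integrable (Function.uncurry H)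
      ((volume.restrict (Ioi 0)).prod (volume : Measure Plane)) := by
    refine (integrable_prod_iff' hmeas).2 ⟨?_, ?_⟩
    · filter_upwards [hne] with ξ hξ
      exact ((hΦi _ (hne' ξ hξ)).ofReal.mul_const (𝓕 (fun y => (f y : ℂ)) ξ)).const_mul
        ((Real.fourierChar (inner ℝ ξ x) : Circle) : ℂ)
    · refine (((hf.integrable_rpow_mul hp hp').const_mul (C * (2 * Real.pi) ^ p))).mono' ?_ ?_
      · exact hmeas.norm.prod_swap.integral_prod_right'
      · filter_upwards [hne] with ξ hξ
        simp only [Function.uncurry_apply_pair, hnorm]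
        rw [Real.norm_of_nonneg (integral_nonneg fun s => by positivity), integral_mul_const]
        have := hb _ (hne' ξ hξ)
        rw [norm_smul, Real.norm_of_nonneg (by positivity), Real.mul_rpow (by positivity)
          (norm_nonneg _)] at this
        rw [← mul_assoc, mul_assoc C]
        gcongr
  have hgH : ∀ s > 0, ∫ ξ, H s ξ = (g s x : ℂ) := fun s hs => by
    rw [← hg s hs x, Real.fourierInv_eq]
    rfl
  constructor
  · have h1 : Integrable (fun s => ∫ ξ, H s ξ) (volume.restrict (Ioi 0)) := hint.integral_prod_left
    have h2 := h1.re
    refine h2.congr ((ae_restrict_mem measurableSet_Ioi).mono fun s hs => ?_)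
    simp [hgH s hs]
  · rw [multiplier, Real.fourierInv_eq]
    have h1 : ∫ ξ : Plane, Real.fourierChar (inner ℝ ξ x) • ((m ((2 * Real.pi) • ξ) : ℂ) *
        𝓕 (fun y => (f y : ℂ)) ξ) = ∫ ξ, ∫ s in Ioi 0, H s ξ := by
      refine integral_congr_ae ?_
      filter_upwards [hne] with ξ hξ
      simp only [hH, Circle.smul_def, smul_eq_mul]
      rw [integral_const_mul, integral_mul_const, integral_complex_ofReal, hΦ _ (hne' ξ hξ)]
    rw [h1, ← integral_integral_swap hint]
    rw [setIntegral_congr_fun measurableSet_Ioi fun s hs => hgH s hs, integral_complex_ofReal,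
      Complex.ofReal_re]

/-- The integrand of the normalization of the heat semigroup formula for `Λ^β`. -/
def fracDensity (β s : ℝ) : ℝ := s ^ (-1 - β / 2) * (1 - Real.exp (-s))

/-- The normalization of the heat semigroup formula for `Λ^β`. -/
def fracConst (β : ℝ) : ℝ := (∫ s in Ioi 0, fracDensity β s)⁻¹

theorem fracDensity_nonneg (β : ℝ) {s : ℝ} (hs : 0 < s) : 0 ≤ fracDensity β s := by
  have : Real.exp (-s) ≤ 1 := Real.exp_le_one_iff.2 (by linarith)
  exact mul_nonneg (by positivity) (by linarith)

theorem integrableOn_fracDensity {β : ℝ} (hβ₀ : 0 < β) (hβ₁ : β ≤ 1) :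
    IntegrableOn (fracDensity β) (Ioi 0) := by
  have hmeas : Measurable (fracDensity β) := by unfold fracDensity; fun_prop
  rw [← Ioc_union_Ioi_eq_Ioi zero_le_one]
  refine IntegrableOn.union ?_ ?_
  · have h1 : IntegrableOn (fun s : ℝ => s ^ (-(β / 2))) (Ioc 0 1) := by
      have := intervalIntegral.intervalIntegrable_rpow' (a := 0) (b := 1) (r := -(β / 2))
        (by linarith)
      rwa [intervalIntegrable_iff_integrableOn_Ioc_of_le zero_le_one] at this
    refine h1.mono' hmeas.aestronglyMeasurable
      ((ae_restrict_mem measurableSet_Ioc).mono fun s hs => ?_)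
    have hs0 : 0 < s := hs.1
    rw [Real.norm_of_nonneg (fracDensity_nonneg β hs0)]
    have h2 : 1 - Real.exp (-s) ≤ s := by linarith [Real.add_one_le_exp (-s)]
    calc fracDensity β s ≤ s ^ (-1 - β / 2) * s := by unfold fracDensity; gcongr
      _ = s ^ (-1 - β / 2) * s ^ (1 : ℝ) := by rw [Real.rpow_one]
      _ = s ^ (-(β / 2)) := by rw [← Real.rpow_add hs0]; ring_nf
  · have h1 : IntegrableOn (fun s : ℝ => s ^ (-1 - β / 2)) (Ioi 1) :=
      integrableOn_Ioi_rpow_of_lt (by linarith) zero_lt_one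
    refine h1.mono' hmeas.aestronglyMeasurable
      ((ae_restrict_mem measurableSet_Ioi).mono fun s hs => ?_)
    have hs0 : 0 < s := zero_lt_one.trans hs
    rw [Real.norm_of_nonneg (fracDensity_nonneg β hs0)]
    exact mul_le_of_le_one_right (by positivity) (by linarith [Real.exp_pos (-s)])

theorem fracConst_pos {β : ℝ} (hβ₀ : 0 < β) (hβ₁ : β ≤ 1) : 0 < fracConst β := by
  refine inv_pos.2 ((setIntegral_pos_iff_support_of_nonneg_ae
    ((ae_restrict_mem measurableSet_Ioi).mono fun s hs => fracDensity_nonneg β hs)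
    (integrableOn_fracDensity hβ₀ hβ₁)).2 ?_)
  have : Ioi (0 : ℝ) ⊆ Function.support (fracDensity β) ∩ Ioi 0 := by
    intro s hs
    have hs0 : 0 < s := hs
    refine ⟨?_, hs⟩
    have : Real.exp (-s) < 1 := Real.exp_lt_one_iff.2 (by linarith)
    exact (mul_pos (by positivity) (by linarith)).ne'
  refine lt_of_lt_of_le ?_ (measure_mono this)
  simp

theorem fracDensity_mul {β l s : ℝ} (hl : 0 < l) (hs : 0 < s) :
    fracDensity β (l * s) = l ^ (-1 - β / 2) * (s ^ (-1 - β / 2) * (1 - Real.exp (-s * l))) := by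
  rw [fracDensity, Real.mul_rpow hl.le hs.le, mul_assoc]
  ring_nf

theorem rpow_cancel {l p : ℝ} (hl : 0 < l) (x : ℝ) : x = l ^ (-p) * (l ^ p * x) := by
  rw [← mul_assoc, ← Real.rpow_add hl]
  simp

theorem integral_rpow_mul_one_sub_exp {β l : ℝ} (hβ₀ : 0 < β) (hβ₁ : β ≤ 1) (hl : 0 < l) :
    IntegrableOn (fun s => s ^ (-1 - β / 2) * (1 - Real.exp (-s * l))) (Ioi 0) ∧
      ∫ s in Ioi 0, s ^ (-1 - β / 2) * (1 - Real.exp (-s * l)) =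
        l ^ (β / 2) * ∫ s in Ioi 0, fracDensity β s := by
  have hcongr : ∀ s ∈ Ioi (0 : ℝ), s ^ (-1 - β / 2) * (1 - Real.exp (-s * l)) =
      l ^ (-(-1 - β / 2)) * fracDensity β (l * s) := fun s hs => by
    rw [fracDensity_mul hl hs]
    exact rpow_cancel hl _
  constructor
  · have h1 := (integrableOn_Ioi_comp_mul_left_iff (fracDensity β) 0 hl).2
      (by simpa using integrableOn_fracDensity hβ₀ hβ₁)
    exact IntegrableOn.congr_fun (h1.const_mul (l ^ (-(-1 - β / 2))))
      (fun s hs => (hcongr s hs).symm) measurableSet_Ioi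
  · rw [setIntegral_congr_fun measurableSet_Ioi hcongr, integral_const_mul,
      integral_comp_mul_left_Ioi _ _ hl, mul_zero, smul_eq_mul, ← mul_assoc]
    congr 1
    rw [← Real.rpow_neg_one, ← Real.rpow_add hl]
    ring_nf

/-- The rescaling s ↦ |ζ|² s shows that |ζ|^β is a constant times ∫ s^(−1−β/2) (1 − exp(−s|ζ|²)) ds,
and 1 − exp(−s|ζ|²) is the symbol of the identity minus the heat flow. -/
theorem fracLaplacian_eq {A β : ℝ} {f : Plane → ℝ} (hβ₀ : 0 < β) (hβ₁ : β ≤ 1)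
    (hf : FourierDecay A f) (x : Plane) :
    IntegrableOn (fun s => s ^ (-1 - β / 2) * (f x - conv (heatKernel s) f x)) (Ioi 0) ∧
      fracLaplacian β f x =
        fracConst β * ∫ s in Ioi 0, s ^ (-1 - β / 2) * (f x - conv (heatKernel s) f x) := by
  have hc := fracConst_pos hβ₀ hβ₁
  have hnn : ∀ s > (0 : ℝ), ∀ ζ : Plane,
      0 ≤ s ^ (-1 - β / 2) * (1 - Real.exp (-s * ‖ζ‖ ^ 2)) := fun s hs ζ => by
    have : Real.exp (-s * ‖ζ‖ ^ 2) ≤ 1 := Real.exp_le_one_iff.2 (by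
      rw [neg_mul]; exact neg_nonpos.2 (by positivity))
    exact mul_nonneg (by positivity) (by linarith)
  have hval : ∀ ζ : Plane, ζ ≠ 0 → ∫ s in Ioi 0, fracConst β * (s ^ (-1 - β / 2) *
      (1 - Real.exp (-s * ‖ζ‖ ^ 2))) = ‖ζ‖ ^ β := fun ζ hζ => by
    have hl : 0 < ‖ζ‖ ^ 2 := by positivity
    rw [integral_const_mul, (integral_rpow_mul_one_sub_exp hβ₀ hβ₁ hl).2, mul_comm, mul_assoc]
    have : (∫ s in Ioi 0, fracDensity β s) * fracConst β = 1 :=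
      mul_inv_cancel₀ fun h => hc.ne' (by rw [fracConst, h, inv_zero])
    rw [this, mul_one, ← Real.rpow_natCast, ← Real.rpow_mul (norm_nonneg _)]
    congr 1
    push_cast
    ring
  have key := multiplier_eq_integral (C := 1) (p := β) (m := fun ζ => ‖ζ‖ ^ β)
    (Φ := fun s ζ => fracConst β * (s ^ (-1 - β / 2) * (1 - Real.exp (-s * ‖ζ‖ ^ 2))))
    (g := fun s x => fracConst β * (s ^ (-1 - β / 2) * (f x - conv (heatKernel s) f x)))
    hf (by linarith) hβ₁ (by unfold Function.uncurry; fun_prop)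
    (fun ζ hζ => (integral_rpow_mul_one_sub_exp hβ₀ hβ₁ (by positivity)).1.const_mul _)
    hval (fun ζ hζ => ?_) (fun s hs x => ?_) x
  · obtain ⟨h1, h2⟩ := key
    refine ⟨?_, ?_⟩
    · refine (h1.const_mul (fracConst β)⁻¹).congr (.of_forall fun s => ?_)
      simp only
      rw [inv_mul_cancel_left₀ hc.ne']
    · rw [fracLaplacian, h2, integral_const_mul]
  · rw [one_mul, ← hval ζ hζ]
    refine (setIntegral_congr_fun measurableSet_Ioi fun s hs => ?_).le
    exact abs_of_nonneg (mul_nonneg hc.le (hnn s hs ζ))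
  · have h1 := fourierInv_fourier_mul_fourier (integrable_heatKernel hs) hf.integrable hf.continuous
      hf.integrable_fourier x
    have h2 := congrFun (Continuous.fourierInv_fourier_eq (f := fun y => (f y : ℂ))
      (Complex.continuous_ofReal.comp hf.continuous) hf.integrable.ofReal hf.integrable_fourier) x
    simp_rw [fourier_heatKernel hs] at h1
    rw [Real.fourierInv_eq] at h1 h2 ⊢
    have hi2 : Integrable fun ξ : Plane =>
        Real.fourierChar (inner ℝ ξ x) • 𝓕 (fun y => (f y : ℂ)) ξ := by
      have := (Real.fourierIntegral_convergent_iff (f := 𝓕 fun y => (f y : ℂ)) (-x)).2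
        hf.integrable_fourier
      simpa using this
    have hi1 : Integrable fun ξ : Plane => Real.fourierChar (inner ℝ ξ x) •
        (((Real.exp (-s * ‖(2 * Real.pi) • ξ‖ ^ 2) : ℝ) : ℂ) * 𝓕 (fun y => (f y : ℂ)) ξ) := by
      have h3 : Integrable fun ξ : Plane =>
          ((Real.exp (-s * ‖(2 * Real.pi) • ξ‖ ^ 2) : ℝ) : ℂ) *
            (Real.fourierChar (inner ℝ ξ x) • 𝓕 (fun y => (f y : ℂ)) ξ) := by
        refine hi2.bdd_mul (c := 1) (by fun_prop) (.of_forall fun ξ => ?_)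
        rw [Complex.norm_real, Real.norm_of_nonneg (Real.exp_pos _).le, Real.exp_le_one_iff,
          neg_mul]
        exact neg_nonpos.2 (by positivity)
      simpa only [mul_smul_comm] using h3
    have h4 : ∀ ξ : Plane, Real.fourierChar (inner ℝ ξ x) •
        (((fracConst β * (s ^ (-1 - β / 2) * (1 - Real.exp (-s * ‖(2 * Real.pi) • ξ‖ ^ 2))) : ℝ) :
          ℂ) * 𝓕 (fun y => (f y : ℂ)) ξ) = ((fracConst β * s ^ (-1 - β / 2) : ℝ) : ℂ) *
        (Real.fourierChar (inner ℝ ξ x) • 𝓕 (fun y => (f y : ℂ)) ξ -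
          Real.fourierChar (inner ℝ ξ x) • (((Real.exp (-s * ‖(2 * Real.pi) • ξ‖ ^ 2) : ℝ) : ℂ) *
            𝓕 (fun y => (f y : ℂ)) ξ)) := fun ξ => by
      simp only [Circle.smul_def, smul_eq_mul]
      push_cast
      ring
    simp_rw [h4]
    rw [integral_const_mul, integral_sub hi2 hi1, h1, h2]
    push_cast
    ring

/-- The Gamma integral of s^((1−β)/2) exp(−s|ζ|²) equals Γ((3−β)/2) |ζ|^(−3+β). The minus sign
appears because the second derivative ∂ᵢ∂ⱼ of the heat kernel has symbol −ζᵢζⱼ exp(−s|ζ|²). -/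
theorem multiplier_riesz_eq {A β σ : ℝ} {f : Plane → ℝ} (i j : Fin 2) (hβ₀ : 0 < β) (hβ₁ : β ≤ 1)
    (hf : FourierDecay A f) (x : Plane) :
    IntegrableOn (fun s => -(σ / Real.Gamma ((3 - β) / 2)) *
        (s ^ ((1 - β) / 2) * conv (heatHess i j s) f x)) (Ioi 0) ∧
      multiplier (fun ζ => ((σ * (ζ i * ζ j * ‖ζ‖ ^ (-3 + β)) : ℝ) : ℂ)) f x =
        ∫ s in Ioi 0, -(σ / Real.Gamma ((3 - β) / 2)) *
          (s ^ ((1 - β) / 2) * conv (heatHess i j s) f x) := by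
  have hΓ : 0 < Real.Gamma ((3 - β) / 2) := Real.Gamma_pos_of_pos (by linarith)
  have hint : ∀ ζ : Plane, ζ ≠ 0 → ∫ s in Ioi 0, s ^ ((1 - β) / 2) * Real.exp (-s * ‖ζ‖ ^ 2) =
      ‖ζ‖ ^ (-3 + β) * Real.Gamma ((3 - β) / 2) := fun ζ hζ => by
    have hl : 0 < ‖ζ‖ ^ 2 := by positivity
    have h := Real.integral_rpow_mul_exp_neg_mul_Ioi (a := (3 - β) / 2) (by linarith) hl
    have h2 : (1 / ‖ζ‖ ^ 2) ^ ((3 - β) / 2) = ‖ζ‖ ^ (-3 + β) := by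
      rw [one_div, ← Real.rpow_natCast, ← Real.rpow_neg (norm_nonneg _),
        ← Real.rpow_mul (norm_nonneg _)]
      congr 1
      push_cast
      ring
    rw [← h2, ← h]
    refine setIntegral_congr_fun measurableSet_Ioi fun s _ => ?_
    congr 2
    · ring
    · ring
  have hnorm : ∀ ζ : Plane, ζ ≠ 0 → 0 < ‖ζ‖ ^ (-3 + β) := fun ζ hζ => by positivity
  have hi : ∀ ζ : Plane, ζ ≠ 0 →
      IntegrableOn (fun s : ℝ => s ^ ((1 - β) / 2) * Real.exp (-s * ‖ζ‖ ^ 2)) (Ioi 0) :=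
    fun ζ hζ => by
      -- A non-integrable function has integral 0 by convention, but the value just computed is
      -- positive.
      by_contra h
      have h2 := hint ζ hζ
      rw [integral_undef h] at h2
      exact absurd h2 (mul_pos (hnorm ζ hζ) hΓ).ne
  have hpt : ∀ (s : ℝ) (ζ : Plane), σ / Real.Gamma ((3 - β) / 2) * (s ^ ((1 - β) / 2) *
      (ζ i * ζ j * Real.exp (-s * ‖ζ‖ ^ 2))) = σ / Real.Gamma ((3 - β) / 2) * (ζ i * ζ j) *
        (s ^ ((1 - β) / 2) * Real.exp (-s * ‖ζ‖ ^ 2)) := fun s ζ => by ring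
  refine multiplier_eq_integral (C := |σ|) (p := β - 1)
    (m := fun ζ => σ * (ζ i * ζ j * ‖ζ‖ ^ (-3 + β)))
    (Φ := fun s ζ => σ / Real.Gamma ((3 - β) / 2) *
      (s ^ ((1 - β) / 2) * (ζ i * ζ j * Real.exp (-s * ‖ζ‖ ^ 2))))
    (g := fun s x => -(σ / Real.Gamma ((3 - β) / 2)) *
      (s ^ ((1 - β) / 2) * conv (heatHess i j s) f x))
    hf (by linarith) (by linarith) (by unfold Function.uncurry; fun_prop)
    (fun ζ hζ => ?_) (fun ζ hζ => ?_) (fun ζ hζ => ?_) (fun s hs x => ?_) x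
  · simp_rw [hpt]
    exact (hi ζ hζ).const_mul _
  · simp_rw [hpt]
    rw [integral_const_mul, hint ζ hζ]
    field_simp
  · have hb : |ζ i * ζ j| ≤ ‖ζ‖ ^ (2 : ℝ) := by
      rw [Real.rpow_two, sq, abs_mul]
      exact mul_le_mul (abs_apply_le _ _) (abs_apply_le _ _) (abs_nonneg _) (norm_nonneg _)
    have h1 : ∀ s ∈ Ioi (0 : ℝ), |σ / Real.Gamma ((3 - β) / 2) * (s ^ ((1 - β) / 2) *
        (ζ i * ζ j * Real.exp (-s * ‖ζ‖ ^ 2)))| = |σ| / Real.Gamma ((3 - β) / 2) * |ζ i * ζ j| *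
        (s ^ ((1 - β) / 2) * Real.exp (-s * ‖ζ‖ ^ 2)) := fun s hs => by
      have hs0 : 0 < s := hs
      rw [hpt, abs_mul, abs_mul, abs_div, abs_of_pos hΓ,
        abs_of_nonneg (by positivity : 0 ≤ s ^ ((1 - β) / 2) * Real.exp (-s * ‖ζ‖ ^ 2))]
    rw [setIntegral_congr_fun measurableSet_Ioi h1, integral_const_mul, hint ζ hζ]
    have hz : 0 < ‖ζ‖ := norm_pos_iff.2 hζ
    calc _ = |σ| * (|ζ i * ζ j| * ‖ζ‖ ^ (-3 + β)) := by field_simp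
      _ ≤ |σ| * (‖ζ‖ ^ (2 : ℝ) * ‖ζ‖ ^ (-3 + β)) := by gcongr
      _ = _ := by rw [← Real.rpow_add hz]; ring_nf
  · have h1 := fourierInv_fourier_mul_fourier (integrable_heatHess i j hs) hf.integrable
      hf.continuous hf.integrable_fourier x
    simp_rw [fourier_heatHess i j hs] at h1
    rw [Real.fourierInv_eq] at h1 ⊢
    have h4 : ∀ ξ : Plane, Real.fourierChar (inner ℝ ξ x) •
        (((σ / Real.Gamma ((3 - β) / 2) * (s ^ ((1 - β) / 2) * (((2 * Real.pi) • ξ) i *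
          ((2 * Real.pi) • ξ) j * Real.exp (-s * ‖(2 * Real.pi) • ξ‖ ^ 2))) : ℝ) : ℂ) *
            𝓕 (fun y => (f y : ℂ)) ξ) =
        ((-(σ / Real.Gamma ((3 - β) / 2)) * s ^ ((1 - β) / 2) : ℝ) : ℂ) *
        (Real.fourierChar (inner ℝ ξ x) • (((-(((2 * Real.pi) • ξ) i * ((2 * Real.pi) • ξ) j *
          Real.exp (-s * ‖(2 * Real.pi) • ξ‖ ^ 2)) : ℝ) : ℂ) * 𝓕 (fun y => (f y : ℂ)) ξ)) :=
      fun ξ => by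
        simp only [Circle.smul_def, smul_eq_mul]
        push_cast
        ring
    simp_rw [h4]
    rw [integral_const_mul, h1]
    push_cast
    ring

/-! ### Dissipation and velocity differences at a maximizing pair -/

/-- The dissipation of the difference `f x - f y`; it is `Λ^β f x - Λ^β f y` up to normalization. -/
def dissipation (β : ℝ) (f : Plane → ℝ) (x y : Plane) : ℝ :=
  ∫ s in Ioi 0, s ^ (-1 - β / 2) * defect f x y (f x - f y) s

section

variable {A β : ℝ} {f : Plane → ℝ} {x y : Plane}

theorem integrableOn_defect (hβ₀ : 0 < β) (hβ₁ : β ≤ 1) (hf : FourierDecay A f) (x y : Plane) :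
    IntegrableOn (fun s => s ^ (-1 - β / 2) * defect f x y (f x - f y) s) (Ioi 0) := by
  refine ((fracLaplacian_eq hβ₀ hβ₁ hf x).1.sub (fracLaplacian_eq hβ₀ hβ₁ hf y).1).congr
    (.of_forall fun s => ?_)
  simp only [Pi.sub_apply, defect]
  ring

theorem fracLaplacian_sub (hβ₀ : 0 < β) (hβ₁ : β ≤ 1) (hf : FourierDecay A f) (x y : Plane) :
    fracLaplacian β f x - fracLaplacian β f y = fracConst β * dissipation β f x y := by
  obtain ⟨hx, hx'⟩ := fracLaplacian_eq hβ₀ hβ₁ hf x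
  obtain ⟨hy, hy'⟩ := fracLaplacian_eq hβ₀ hβ₁ hf y
  rw [hx', hy', ← mul_sub, ← integral_sub hx hy, dissipation]
  congr 2
  ext s
  simp only [defect]
  ring

theorem dissipation_nonneg (hf : FourierDecay A f) (h : ∀ z, f (x - z) - f (y - z) ≤ f x - f y) :
    0 ≤ dissipation β f x y :=
  setIntegral_nonneg measurableSet_Ioi fun _ hs =>
    mul_nonneg (Real.rpow_nonneg (le_of_lt hs) _) (defect_nonneg hf.integrable hs h)

/-- By `hle`, smoothing of the Hölder function `f` leaves at most half of the difference for s > r²,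
so the defect there is at least half of it. Integrating s^(−1−β/2) over s > r² supplies (2/β)
r^(−β); shorter times only help. -/
theorem le_dissipation {Q α r : ℝ} (hβ₀ : 0 < β) (hβ₁ : β ≤ 1) (hf : FourierDecay A f)
    (h : ∀ z, f (x - z) - f (y - z) ≤ f x - f y) (hα0 : 0 ≤ α) (hα1 : α < 1) (hQ0 : 0 ≤ Q)
    (hQ : ∀ x y, |f x - f y| ≤ Q * ‖x - y‖ ^ α) (hr : 0 < r)
    (hle : 2048 * r ^ (α - 1) * Q * ‖x - y‖ ≤ (f x - f y) / 2) :
    (f x - f y) / β * r ^ (-β) ≤ dissipation β f x y := by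
  have hi := integrableOn_defect hβ₀ hβ₁ hf x y
  have hr2 : 0 < r ^ 2 := by positivity
  have hpow : ∀ p : ℝ, (r ^ 2) ^ p = r ^ (2 * p) := fun p => by
    rw [← Real.rpow_natCast, ← Real.rpow_mul hr.le]; norm_num
  have hi0 : IntegrableOn (fun s : ℝ => s ^ (-1 - β / 2)) (Ioi (r ^ 2)) :=
    integrableOn_Ioi_rpow_of_lt (by linarith) hr2
  have hsub : Ioi (r ^ 2) ⊆ Ioi (0 : ℝ) := Ioi_subset_Ioi hr2.le
  calc (f x - f y) / β * r ^ (-β)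
      = ∫ s in Ioi (r ^ 2), s ^ (-1 - β / 2) * ((f x - f y) / 2) := by
        rw [integral_mul_const, integral_Ioi_rpow_of_lt (by linarith) hr2, hpow,
          show 2 * (-1 - β / 2 + 1) = -β by ring, show -1 - β / 2 + 1 = -(β / 2) by ring]
        field_simp
    _ ≤ ∫ s in Ioi (r ^ 2), s ^ (-1 - β / 2) * defect f x y (f x - f y) s := by
        refine setIntegral_mono_on (hi0.mul_const _) (hi.mono_set hsub) measurableSet_Ioi
          fun s hs => ?_
        have hs0 : 0 < s := hsub hs
        have hs' : r ^ 2 ≤ s := le_of_lt hs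
        refine mul_le_mul_of_nonneg_left ?_ (Real.rpow_nonneg hs0.le _)
        have h1 := (le_abs_self _).trans
          (abs_conv_heatKernel_sub_le hf.integrable hs0 hα0 hα1.le hQ0 hQ x y)
        have h2 : s ^ ((α - 1) / 2) ≤ r ^ (α - 1) := by
          calc s ^ ((α - 1) / 2) ≤ (r ^ 2) ^ ((α - 1) / 2) :=
                Real.rpow_le_rpow_of_nonpos hr2 hs' (by linarith)
            _ = _ := by rw [hpow]; ring_nf
        have h3 : 2048 * s ^ ((α - 1) / 2) * Q * ‖x - y‖ ≤ 2048 * r ^ (α - 1) * Q * ‖x - y‖ := by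
          gcongr
        rw [defect]
        linarith
    _ ≤ dissipation β f x y :=
        setIntegral_mono_set hi ((ae_restrict_mem measurableSet_Ioi).mono fun s hs =>
          mul_nonneg (Real.rpow_nonneg (le_of_lt hs) _) (defect_nonneg hf.integrable hs h))
          hsub.eventuallyLE

theorem integral_defect_two_mul (β : ℝ) (f : Plane → ℝ) (x y : Plane) :
    ∫ s in Ioi 0, s ^ (-1 - β / 2) * defect f x y (f x - f y) (2 * s) =
      2 ^ (β / 2) * dissipation β f x y := by
  have h1 : ∀ s ∈ Ioi (0 : ℝ), s ^ (-1 - β / 2) * defect f x y (f x - f y) (2 * s) =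
      2 ^ (-(-1 - β / 2)) * ((2 * s) ^ (-1 - β / 2) * defect f x y (f x - f y) (2 * s)) :=
    fun s hs => by
      have hs0 : 0 < s := hs
      rw [Real.mul_rpow zero_le_two hs0.le, mul_assoc]
      exact rpow_cancel zero_lt_two _
  rw [setIntegral_congr_fun measurableSet_Ioi h1, integral_const_mul,
    integral_comp_mul_left_Ioi (fun s => s ^ (-1 - β / 2) * defect f x y (f x - f y) s) 0
      zero_lt_two, mul_zero, smul_eq_mul, ← mul_assoc, dissipation]
  congr 1
  rw [← Real.rpow_neg_one, ← Real.rpow_add zero_lt_two]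
  ring_nf

/-- The heat times are split at ρ². Below, s^((1−β)/2) s^(−1) = √s s^(−1−β/2) is at most ρ times the
weight of the dissipation. Above, Hölder smoothing leaves s^(−1+(α−β)/2), integrable at infinity
because α < β; the stronger condition α ≤ β/2 keeps the constant free of α. -/
theorem abs_multiplier_riesz_sub_le {Q α ρ σ : ℝ} (i j : Fin 2) (hβ₀ : 0 < β) (hβ₁ : β ≤ 1)
    (hf : FourierDecay A f) (h : ∀ z, f (x - z) - f (y - z) ≤ f x - f y) (hα0 : 0 ≤ α)
    (hα : α ≤ β / 2) (hQ0 : 0 ≤ Q) (hQ : ∀ x y, |f x - f y| ≤ Q * ‖x - y‖ ^ α) (hρ : 0 < ρ)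
    (hσ : |σ| = 1) :
    |multiplier (fun ζ => ((σ * (ζ i * ζ j * ‖ζ‖ ^ (-3 + β)) : ℝ) : ℂ)) f x -
      multiplier (fun ζ => ((σ * (ζ i * ζ j * ‖ζ‖ ^ (-3 + β)) : ℝ) : ℂ)) f y| ≤
      8192 / (β * Real.Gamma ((3 - β) / 2)) *
        (ρ * dissipation β f x y + ‖x - y‖ * Q * ρ ^ (α - β)) := by
  have hΓ : 0 < Real.Gamma ((3 - β) / 2) := Real.Gamma_pos_of_pos (by linarith)
  obtain ⟨hx, hx'⟩ := multiplier_riesz_eq (σ := σ) i j hβ₀ hβ₁ hf x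
  obtain ⟨hy, hy'⟩ := multiplier_riesz_eq (σ := σ) i j hβ₀ hβ₁ hf y
  have hρ2 : 0 < ρ ^ 2 := by positivity
  have hD := dissipation_nonneg (β := β) hf h
  have hpow : ∀ p : ℝ, (ρ ^ 2) ^ p = ρ ^ (2 * p) := fun p => by
    rw [← Real.rpow_natCast, ← Real.rpow_mul hρ.le]; norm_num
  set near : ℝ → ℝ := fun s =>
    2048 * ρ * (s ^ (-1 - β / 2) * defect f x y (f x - f y) (2 * s)) with hnear
  set far : ℝ → ℝ := (Ioi (ρ ^ 2)).indicator fun s =>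
    2048 * Q * ‖x - y‖ * s ^ (-1 + (α - β) / 2) with hfar
  have hnear_i : IntegrableOn near (Ioi 0) := by
    have h1 := (integrableOn_Ioi_comp_mul_left_iff
      (fun s => s ^ (-1 - β / 2) * defect f x y (f x - f y) s) 0 zero_lt_two).2
      (by simpa using integrableOn_defect hβ₀ hβ₁ hf x y)
    refine IntegrableOn.congr_fun (h1.const_mul (2048 * ρ * 2 ^ (-(-1 - β / 2)))) (fun s hs => ?_)
      measurableSet_Ioi
    have hs0 : 0 < s := hs
    simp only [hnear]
    rw [Real.mul_rpow zero_le_two hs0.le, mul_assoc (2048 * ρ), mul_assoc (2 ^ (-1 - β / 2)),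
      ← rpow_cancel zero_lt_two]
  have hfar0 : IntegrableOn (fun s : ℝ => 2048 * Q * ‖x - y‖ * s ^ (-1 + (α - β) / 2))
      (Ioi (ρ ^ 2)) := (integrableOn_Ioi_rpow_of_lt (by linarith) hρ2).const_mul _
  have hfar_i : Integrable far := (integrable_indicator_iff measurableSet_Ioi).2 hfar0
  have hpt : ∀ s ∈ Ioi (0 : ℝ), ‖-(σ / Real.Gamma ((3 - β) / 2)) *
      (s ^ ((1 - β) / 2) * conv (heatHess i j s) f x) - -(σ / Real.Gamma ((3 - β) / 2)) *
      (s ^ ((1 - β) / 2) * conv (heatHess i j s) f y)‖ ≤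
        (Real.Gamma ((3 - β) / 2))⁻¹ * (near s + far s) := by
    intro s hs
    have hs0 : 0 < s := hs
    have h2s : 0 < 2 * s := by positivity
    have hd := defect_nonneg hf.integrable h2s h
    rw [← mul_sub, ← mul_sub, norm_mul, norm_neg, norm_div, Real.norm_eq_abs, hσ,
      Real.norm_of_nonneg hΓ.le, one_div, norm_mul, Real.norm_of_nonneg (by positivity),
      Real.norm_eq_abs]
    refine mul_le_mul_of_nonneg_left ?_ (inv_nonneg.2 hΓ.le)
    rcases le_or_gt s (ρ ^ 2) with hsρ | hsρ
    · have h1 : far s = 0 := indicator_of_notMem (by simpa using hsρ) _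
      rw [h1, add_zero]
      have h2 : s ^ ((1 - β) / 2) * s⁻¹ ≤ ρ * s ^ (-1 - β / 2) := by
        calc s ^ ((1 - β) / 2) * s⁻¹ = √s * s ^ (-1 - β / 2) := by
              rw [Real.sqrt_eq_rpow, ← Real.rpow_neg_one, ← Real.rpow_add hs0, ← Real.rpow_add hs0]
              ring_nf
          _ ≤ ρ * s ^ (-1 - β / 2) := by
              gcongr
              exact Real.sqrt_le_iff.2 ⟨hρ.le, hsρ⟩
      calc _ ≤ s ^ ((1 - β) / 2) * (2048 * s⁻¹ * defect f x y (f x - f y) (2 * s)) := by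
            gcongr
            exact abs_conv_heatHess_sub_le_defect i j hf.integrable hs0 h
        _ = 2048 * (s ^ ((1 - β) / 2) * s⁻¹) * defect f x y (f x - f y) (2 * s) := by ring
        _ ≤ 2048 * (ρ * s ^ (-1 - β / 2)) * defect f x y (f x - f y) (2 * s) := by gcongr
        _ = near s := by simp only [hnear]; ring
    · have h1 : far s = 2048 * Q * ‖x - y‖ * s ^ (-1 + (α - β) / 2) :=
        indicator_of_mem (by simpa using hsρ) _
      have h2 : 0 ≤ near s := by simp only [hnear]; positivity
      have h3 : s ^ (-1 + (α - β) / 2) = s ^ ((1 - β) / 2) * s ^ ((α - 3) / 2) := by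
        rw [← Real.rpow_add hs0]
        ring_nf
      calc _ ≤ s ^ ((1 - β) / 2) * (2048 * s ^ ((α - 3) / 2) * Q * ‖x - y‖) := by
            gcongr
            exact abs_conv_heatHess_sub_le i j hf.integrable hs0 hα0 (by linarith) hQ0 hQ x y
        _ = far s := by rw [h1, h3]; ring
        _ ≤ near s + far s := by linarith
  have hnear_v : ∫ s in Ioi 0, near s ≤ 4096 * (ρ * dissipation β f x y) := by
    simp only [hnear]
    rw [integral_const_mul, integral_defect_two_mul]
    have : (2 : ℝ) ^ (β / 2) ≤ 2 := by
      calc (2 : ℝ) ^ (β / 2) ≤ 2 ^ (1 : ℝ) :=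
            Real.rpow_le_rpow_of_exponent_le one_le_two (by linarith)
        _ = 2 := Real.rpow_one 2
    calc _ ≤ 2048 * ρ * (2 * dissipation β f x y) := by gcongr
      _ = _ := by ring
  have hfar_v : ∫ s in Ioi 0, far s ≤ 8192 / β * (‖x - y‖ * Q * ρ ^ (α - β)) := by
    simp only [hfar]
    rw [setIntegral_indicator measurableSet_Ioi, Ioi_inter_Ioi, max_eq_right hρ2.le,
      integral_const_mul, integral_Ioi_rpow_of_lt (by linarith) hρ2, hpow,
      show -1 + (α - β) / 2 + 1 = (α - β) / 2 by ring, show 2 * ((α - β) / 2) = α - β by ring]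
    have h1 : -ρ ^ (α - β) / ((α - β) / 2) = ρ ^ (α - β) * (2 / (β - α)) := by
      have : α - β ≠ 0 := by linarith
      have : β - α ≠ 0 := by linarith
      field_simp
      ring
    have h2 : 2 / (β - α) ≤ 4 / β := by
      rw [div_le_div_iff₀ (by linarith) hβ₀]
      linarith
    rw [h1]
    calc _ ≤ 2048 * Q * ‖x - y‖ * (ρ ^ (α - β) * (4 / β)) := by gcongr
      _ = _ := by ring
  rw [hx', hy', ← integral_sub hx hy, ← Real.norm_eq_abs]
  refine (norm_integral_le_of_norm_le ((hnear_i.add hfar_i.integrableOn).const_mul _)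
    ((ae_restrict_mem measurableSet_Ioi).mono hpt)).trans ?_
  simp only [Pi.add_apply]
  rw [integral_const_mul, integral_add hnear_i hfar_i.integrableOn]
  have h3 : 4096 * (ρ * dissipation β f x y) ≤ 8192 / β * (ρ * dissipation β f x y) := by
    gcongr
    rw [le_div_iff₀ hβ₀]
    linarith
  calc _ ≤ (Real.Gamma ((3 - β) / 2))⁻¹ * (8192 / β * (ρ * dissipation β f x y) +
        8192 / β * (‖x - y‖ * Q * ρ ^ (α - β))) := by
        gcongr
        exact hnear_v.trans h3
    _ = _ := by field_simp

/-- The constant in the bound for velocity differences. -/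
def velocityConst (β : ℝ) : ℝ := 16384 / (β * Real.Gamma ((3 - β) / 2))

theorem velocityConst_pos (hβ₀ : 0 < β) (hβ₁ : β ≤ 1) : 0 < velocityConst β := by
  have hΓ : 0 < Real.Gamma ((3 - β) / 2) := Real.Gamma_pos_of_pos (by linarith)
  unfold velocityConst
  positivity

theorem norm_inducedVelocity_sub_le {Q α ρ : ℝ} (hβ₀ : 0 < β) (hβ₁ : β ≤ 1)
    (hf : FourierDecay A f) (h : ∀ z, f (x - z) - f (y - z) ≤ f x - f y) (hα0 : 0 ≤ α)
    (hα : α ≤ β / 2) (hQ0 : 0 ≤ Q) (hQ : ∀ x y, |f x - f y| ≤ Q * ‖x - y‖ ^ α) (hρ : 0 < ρ) :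
    ‖inducedVelocity β f x - inducedVelocity β f y‖ ≤
      velocityConst β * (ρ * dissipation β f x y + ‖x - y‖ * Q * ρ ^ (α - β)) := by
  have h0 : ∀ x, (inducedVelocity β f x) 0 =
      multiplier (fun ζ => (((-1 : ℝ) * (ζ 0 * ζ 1 * ‖ζ‖ ^ (-3 + β)) : ℝ) : ℂ)) f x := fun x => by
    simp only [inducedVelocity, Matrix.cons_val_zero]
    congr 1
    ext ζ
    push_cast
    linear_combination (ζ 0 * ζ 1 * ((‖ζ‖ ^ (-3 + β) : ℝ) : ℂ)) * Complex.I_sq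
  have h1 : ∀ x, (inducedVelocity β f x) 1 =
      multiplier (fun ζ => (((1 : ℝ) * (ζ 0 * ζ 0 * ‖ζ‖ ^ (-3 + β)) : ℝ) : ℂ)) f x := fun x => by
    simp only [inducedVelocity, Matrix.cons_val_one, Matrix.cons_val_zero]
    congr 1
    ext ζ
    push_cast
    linear_combination (-(ζ 0 * ζ 0 * ((‖ζ‖ ^ (-3 + β) : ℝ) : ℂ))) * Complex.I_sq
  have hb0 := abs_multiplier_riesz_sub_le (σ := -1) 0 1 hβ₀ hβ₁ hf h hα0 hα hQ0 hQ hρ (by simp)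
  have hb1 := abs_multiplier_riesz_sub_le (σ := 1) 0 0 hβ₀ hβ₁ hf h hα0 hα hQ0 hQ hρ (by simp)
  rw [← h0, ← h0] at hb0
  rw [← h1, ← h1] at hb1
  set d := inducedVelocity β f x - inducedVelocity β f y with hd
  have hn : ‖d‖ ≤ |d 0| + |d 1| := by
    rw [EuclideanSpace.norm_eq, Fin.sum_univ_two, Real.norm_eq_abs, Real.norm_eq_abs]
    refine Real.sqrt_le_iff.2 ⟨by positivity, ?_⟩
    nlinarith [abs_nonneg (d 0), abs_nonneg (d 1)]
  refine hn.trans ((add_le_add hb0 hb1).trans_eq ?_)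
  unfold velocityConst
  ring

end

/-! ### Boundedness, Lipschitz continuity and decay from the Fourier side -/

/-- Bounds on up to four derivatives in L¹ control the transform by K and |ξ|⁴ times it by 2⁴ · 5 ·
K = 80K. With (1+|ξ|)⁴ ≤ 8(1+|ξ|⁴) this gives 8 · 81 = 648. -/
theorem fourierDecay_of_contDiff {f : Plane → ℝ} {K : ℝ≥0} (hf : ContDiff ℝ ∞ f)
    (hK : ∀ k ≤ 4, eLpNorm (iteratedFDeriv ℝ k f) 1 volume ≤ K) : FourierDecay (648 * K) f := by
  have hcd : ContDiff ℝ ∞ (fun y => (f y : ℂ)) := Complex.ofRealCLM.contDiff.comp hf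
  have hnorm : ∀ (k : ℕ) (y : Plane), ‖iteratedFDeriv ℝ k (fun y => (f y : ℂ)) y‖ =
      ‖iteratedFDeriv ℝ k f y‖ := fun k y =>
    Complex.ofRealLI.norm_iteratedFDeriv_comp_left (hf.contDiffAt) (by exact_mod_cast le_top)
  have hi : ∀ k ≤ 4, Integrable (iteratedFDeriv ℝ k f) := fun k hk =>
    memLp_one_iff_integrable.1 ⟨(hf.continuous_iteratedFDeriv
      (by exact_mod_cast le_top)).aestronglyMeasurable, (hK k hk).trans_lt ENNReal.coe_lt_top⟩
  have hint : ∀ k ≤ 4, ∫ y, ‖iteratedFDeriv ℝ k f y‖ ≤ K := fun k hk => by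
    have h1 := hK k hk
    rw [eLpNorm_one_eq_lintegral_enorm, ← ofReal_integral_norm_eq_lintegral_enorm (hi k hk)] at h1
    have h2 := ENNReal.toReal_mono ENNReal.coe_ne_top h1
    rwa [ENNReal.toReal_ofReal (integral_nonneg fun _ => norm_nonneg _), ENNReal.coe_toReal] at h2
  have hi0 : Integrable f := by
    have h := (hi 0 (by norm_num)).norm
    simp only [norm_iteratedFDeriv_zero] at h
    exact (integrable_norm_iff hf.continuous.aestronglyMeasurable).1 h
  refine ⟨hf.continuous, hi0, fun ξ => ?_⟩
  have hpow : ∀ n : ℕ, n ≤ 4 → ‖ξ‖ ^ n * ‖𝓕 (fun y => (f y : ℂ)) ξ‖ ≤ 2 ^ n * ((n + 1) * K) := by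
    intro n hn
    have h := Real.pow_mul_norm_iteratedFDeriv_fourier_le (K := 0) (N := n) (k := 0) (n := n)
      (f := fun y => (f y : ℂ)) (hcd.of_le (by exact_mod_cast le_top)) (fun k m hk hm => ?_) le_rfl
      le_rfl ξ
    · simp only [norm_iteratedFDeriv_zero] at h
      refine h.trans ?_
      have h3 : ∑ p ∈ Finset.range (0 + 1) ×ˢ Finset.range (n + 1),
          ∫ v : Plane, ‖v‖ ^ p.1 * ‖iteratedFDeriv ℝ p.2 (fun y => (f y : ℂ)) v‖ ≤
          ∑ p ∈ Finset.range (0 + 1) ×ˢ Finset.range (n + 1), (K : ℝ) := by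
        refine Finset.sum_le_sum fun p hp => ?_
        simp only [Finset.mem_product, Finset.mem_range] at hp
        have hp1 : p.1 = 0 := by omega
        simp only [hp1, pow_zero, one_mul, hnorm]
        exact hint _ (by omega)
      have h4 : ∑ p ∈ Finset.range (0 + 1) ×ˢ Finset.range (n + 1), (K : ℝ) = (n + 1) * K := by
        simp
      rw [h4] at h3
      simp only [pow_zero, Nat.cast_zero, mul_zero, zero_add, one_mul]
      gcongr
    · have hk0 : k = 0 := by simpa using hk
      have hm' : m ≤ n := by exact_mod_cast hm
      simp only [hk0, pow_zero, one_mul, hnorm]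
      exact (hi m (by omega)).norm
  have h0 := hpow 0 (by norm_num)
  have h4 := hpow 4 le_rfl
  rw [Real.rpow_neg (by positivity), ← div_eq_mul_inv, le_div_iff₀ (by positivity)]
  rw [show (4 : ℝ) = ((4 : ℕ) : ℝ) by norm_num, Real.rpow_natCast]
  have h5 : (1 + ‖ξ‖) ^ 4 ≤ 8 * (1 + ‖ξ‖ ^ 4) := by
    have h6 := sq_nonneg (‖ξ‖ - 1)
    have h7 := sq_nonneg (‖ξ‖ ^ 2 - 1)
    have h8 : (1 + ‖ξ‖) ^ 2 ≤ 2 * (1 + ‖ξ‖ ^ 2) := by nlinarith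
    calc (1 + ‖ξ‖) ^ 4 = ((1 + ‖ξ‖) ^ 2) ^ 2 := by ring
      _ ≤ (2 * (1 + ‖ξ‖ ^ 2)) ^ 2 := by gcongr
      _ ≤ _ := by nlinarith
  norm_num at h0 h4
  calc _ ≤ ‖𝓕 (fun y => (f y : ℂ)) ξ‖ * (8 * (1 + ‖ξ‖ ^ 4)) := by gcongr
    _ ≤ 648 * K := by nlinarith

namespace FourierDecay

variable {A : ℝ} {f : Plane → ℝ}

theorem nonneg (hf : FourierDecay A f) : 0 ≤ A := by
  have := (norm_nonneg _).trans (hf.bound 0)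
  simpa using this

theorem eq_fourier (hf : FourierDecay A f) (x : Plane) :
    (f x : ℂ) = 𝓕 (𝓕 fun y => (f y : ℂ)) (-x) := by
  rw [← Real.fourierInv_eq_fourier_neg]
  exact (congrFun (Continuous.fourierInv_fourier_eq (f := fun y => (f y : ℂ))
    (Complex.continuous_ofReal.comp hf.continuous) hf.integrable.ofReal hf.integrable_fourier) x).symm

theorem norm_integral_rpow_le (hf : FourierDecay A f) {p : ℝ} (hp : -1 ≤ p) (hp' : p ≤ 1) :
    ∫ ξ : Plane, ‖ξ‖ ^ p * ‖𝓕 (fun y => (f y : ℂ)) ξ‖ ≤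
      A * ∫ ξ : Plane, ‖ξ‖ ^ p * (1 + ‖ξ‖) ^ (-4 : ℝ) := by
  rw [← integral_const_mul]
  refine integral_mono (hf.integrable_rpow_mul hp hp')
    ((integrable_rpow_norm_mul hp hp').const_mul A) fun ξ => ?_
  calc _ ≤ ‖ξ‖ ^ p * (A * (1 + ‖ξ‖) ^ (-4 : ℝ)) := by gcongr; exact hf.bound ξ
    _ = _ := by ring

theorem abs_le (hf : FourierDecay A f) (x : Plane) :
    |f x| ≤ A * ∫ ξ : Plane, ‖ξ‖ ^ (0 : ℝ) * (1 + ‖ξ‖) ^ (-4 : ℝ) := by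
  rw [← Real.norm_eq_abs, ← Complex.norm_real, hf.eq_fourier]
  refine le_trans ?_ (hf.norm_integral_rpow_le (p := 0) (by norm_num) (by norm_num))
  simp only [Real.rpow_zero, one_mul]
  exact VectorFourier.norm_fourierIntegral_le_integral_norm _ _ _ _ _

theorem abs_sub_le (hf : FourierDecay A f) (x y : Plane) :
    |f x - f y| ≤
      (2 * Real.pi * (A * ∫ ξ : Plane, ‖ξ‖ ^ (1 : ℝ) * (1 + ‖ξ‖) ^ (-4 : ℝ))) * ‖x - y‖ := by
  have hi : Integrable fun ξ : Plane => ‖ξ‖ * ‖𝓕 (fun y => (f y : ℂ)) ξ‖ := by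
    simpa using hf.integrable_rpow_mul (p := 1) (by norm_num) le_rfl
  have hb : ∀ z, ‖𝓕 (VectorFourier.fourierSMulRight (innerSL ℝ) (𝓕 fun y => (f y : ℂ))) z‖ ≤
      2 * Real.pi * (A * ∫ ξ : Plane, ‖ξ‖ ^ (1 : ℝ) * (1 + ‖ξ‖) ^ (-4 : ℝ)) := fun z => by
    refine (VectorFourier.norm_fourierIntegral_le_integral_norm _ _ _ _ _).trans ?_
    have h1 : ∀ ξ, ‖VectorFourier.fourierSMulRight (innerSL ℝ) (𝓕 fun y => (f y : ℂ)) ξ‖ ≤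
        2 * Real.pi * (‖ξ‖ * ‖𝓕 (fun y => (f y : ℂ)) ξ‖) := fun ξ => by
      refine (VectorFourier.norm_fourierSMulRight (innerSL ℝ) _ ξ).le.trans_eq ?_
      rw [innerSL_apply_norm, mul_assoc]
    refine (integral_mono_of_nonneg (.of_forall fun ξ => norm_nonneg _) (hi.const_mul _)
      (.of_forall h1)).trans ?_
    rw [integral_const_mul]
    gcongr
    simpa only [Real.rpow_one] using hf.norm_integral_rpow_le (p := 1) (by norm_num) le_rfl
  have h := convex_univ.norm_image_sub_le_of_norm_hasFDerivWithin_le (𝕜 := ℝ)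
    (f := 𝓕 (𝓕 fun y => (f y : ℂ)))
    (fun z _ => (Real.hasFDerivAt_fourier hf.integrable_fourier hi z).hasFDerivWithinAt)
    (fun z _ => hb z) (mem_univ (-y)) (mem_univ (-x))
  rw [← hf.eq_fourier, ← hf.eq_fourier, ← Complex.ofReal_sub, Complex.norm_real,
    Real.norm_eq_abs] at h
  refine h.trans_eq ?_
  congr 1
  rw [← norm_neg]
  congr 1
  abel

/-- By inversion `f` is, up to reflection, the Fourier transform of an integrable function, so the
Riemann–Lebesgue lemma applies. -/
theorem tendsto_zero (hf : FourierDecay A f) :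
    Filter.Tendsto f (Filter.cocompact Plane) (nhds 0) := by
  have h1 : Filter.Tendsto (𝓕 (𝓕 fun y => (f y : ℂ))) (Filter.cocompact Plane) (nhds 0) :=
    tendsto_integral_exp_inner_smul_cocompact _
  have h2 := h1.comp (Homeomorph.neg Plane).isClosedEmbedding.tendsto_cocompact
  have h3 := (Complex.continuous_re.tendsto 0).comp h2
  refine h3.congr fun x => ?_
  simp only [Function.comp_apply, Homeomorph.coe_neg, ← hf.eq_fourier, Complex.ofReal_re]

end FourierDecay

/-- A positive supremum cannot be approached only at infinity, where the function tends to zero. -/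
theorem exists_eq_of_isLUB_of_tendsto_zero {g : Plane → ℝ} (hg : Continuous g)
    (h0 : Filter.Tendsto g (Filter.cocompact Plane) (nhds 0)) {s : ℝ} (hs : 0 < s)
    (hlub : IsLUB (range g) s) : ∃ x, g x = s ∧ ∀ y, g y ≤ g x := by
  obtain ⟨_, ⟨x₀, rfl⟩, hx₀, -⟩ := hlub.exists_between (half_lt_self hs)
  obtain ⟨x, hx⟩ := hg.exists_forall_ge' x₀
    ((h0.eventually_le_const (half_pos hs)).mono fun y hy => hy.trans hx₀.le)
  refine ⟨x, le_antisymm (hlub.1 ⟨x, rfl⟩) (hlub.2 ?_), hx⟩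
  rintro _ ⟨y, rfl⟩
  exact hx y

/-! ### Maximum principle for the solution -/

theorem conv_heatKernel_le {f : Plane → ℝ} (hf : Integrable f) {s : ℝ} (hs : 0 < s) {x : Plane}
    {N : ℝ} (hN : ∀ z, f z ≤ N) : conv (heatKernel s) f x ≤ N := by
  rw [conv_eq]
  calc _ ≤ ∫ z, heatKernel s z * N :=
        integral_mono (integrable_mul_comp_sub (continuous_heatKernel s) (abs_heatKernel_le hs) hf x)
          ((integrable_heatKernel hs).mul_const N) fun z =>
            mul_le_mul_of_nonneg_left (hN _) (heatKernel_pos hs z).le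
    _ = N := by rw [integral_mul_const, integral_heatKernel hs, one_mul]

theorem le_conv_heatKernel {f : Plane → ℝ} (hf : Integrable f) {s : ℝ} (hs : 0 < s) {x : Plane}
    {N : ℝ} (hN : ∀ z, N ≤ f z) : N ≤ conv (heatKernel s) f x := by
  rw [conv_eq]
  calc N = ∫ z, heatKernel s z * N := by rw [integral_mul_const, integral_heatKernel hs, one_mul]
    _ ≤ _ :=
        integral_mono ((integrable_heatKernel hs).mul_const N)
          (integrable_mul_comp_sub (continuous_heatKernel s) (abs_heatKernel_le hs) hf x) fun z =>
            mul_le_mul_of_nonneg_left (hN _) (heatKernel_pos hs z).le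

/-- The heat flow averages, so it cannot exceed a maximum; the integrand of the heat formula is
nonnegative. -/
theorem fracLaplacian_nonneg_of_max {A β : ℝ} {f : Plane → ℝ} (hβ₀ : 0 < β) (hβ₁ : β ≤ 1)
    (hf : FourierDecay A f) {x : Plane} (hx : ∀ y, f y ≤ f x) : 0 ≤ fracLaplacian β f x := by
  rw [(fracLaplacian_eq hβ₀ hβ₁ hf x).2]
  exact mul_nonneg (fracConst_pos hβ₀ hβ₁).le (setIntegral_nonneg measurableSet_Ioi fun s hs =>
    mul_nonneg (Real.rpow_nonneg (le_of_lt hs) _)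
      (sub_nonneg.2 (conv_heatKernel_le hf.integrable hs hx)))

theorem fracLaplacian_nonpos_of_min {A β : ℝ} {f : Plane → ℝ} (hβ₀ : 0 < β) (hβ₁ : β ≤ 1)
    (hf : FourierDecay A f) {x : Plane} (hx : ∀ y, f x ≤ f y) : fracLaplacian β f x ≤ 0 := by
  rw [(fracLaplacian_eq hβ₀ hβ₁ hf x).2]
  exact mul_nonpos_of_nonneg_of_nonpos (fracConst_pos hβ₀ hβ₁).le
    (setIntegral_nonpos measurableSet_Ioi fun s hs =>
      mul_nonpos_of_nonneg_of_nonpos (Real.rpow_nonneg (le_of_lt hs) _)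
        (sub_nonpos.2 (le_conv_heatKernel hf.integrable hs hx)))

namespace IsSmoothSolution

variable {β T : ℝ} {w : ℝ → Plane → Plane} {θ₀ : Plane → ℝ} {θ : ℝ → Plane → ℝ}

theorem fourierDecay (hθ : IsSmoothSolution β T w θ₀ θ) :
    ∃ A, ∀ t ∈ Icc 0 T, FourierDecay A (θ t) := by
  obtain ⟨K, hK⟩ := hθ.decay
  exact ⟨648 * K, fun t ht => fourierDecay_of_contDiff (hθ.smooth t ht) (hK t ht)⟩

/-- The maximum principle for the solution. -/
theorem abs_le_of_initial (hθ : IsSmoothSolution β T w θ₀ θ) (hβ₀ : 0 < β) (hβ₁ : β ≤ 1) {H : ℝ}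
    (hH : ∀ x, |θ₀ x| ≤ H) : ∀ t ∈ Icc 0 T, ∀ x, |θ t x| ≤ H := by
  obtain ⟨A, hA⟩ := hθ.fourierDecay
  obtain ⟨K, hK⟩ := hθ.lipschitz_time
  have hH0 : 0 ≤ H := (abs_nonneg _).trans (hH 0)
  have hup : ∀ t ∈ Icc 0 T, ∀ x, θ t x ≤ H := by
    refine le_of_deriv_nonpos_at_sup (F := fun x t => θ t x) hK (fun t ht => ?_)
      (fun x => by rw [hθ.initial]; exact (le_abs_self _).trans (hH x)) ?_
    · exact ⟨_, by rintro _ ⟨x, rfl⟩; exact (le_abs_self _).trans ((hA t ht).abs_le x)⟩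
    · filter_upwards [hθ.equation, ae_restrict_mem measurableSet_Ioo] with t ht htI s hs hlub
      have htT := Ioo_subset_Icc_self htI
      obtain ⟨x, hx, hmax⟩ := exists_eq_of_isLUB_of_tendsto_zero (hA t htT).continuous
        (hA t htT).tendsto_zero (hH0.trans_lt hs) hlub
      obtain ⟨d, hd, heq⟩ := ht x
      refine ⟨x, hx, d, ?_, hd⟩
      -- The transport term vanishes at a spatial maximum, whatever the velocity; only the
      -- dissipation is left.
      have h1 : fderiv ℝ (θ t) x = 0 := IsLocalMax.fderiv_eq_zero (.of_forall hmax)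
      have h2 := fracLaplacian_nonneg_of_max hβ₀ hβ₁ (hA t htT) hmax
      rw [h1] at heq
      simp only [zero_apply] at heq
      linarith
  have hlo : ∀ t ∈ Icc 0 T, ∀ x, -θ t x ≤ H := by
    refine le_of_deriv_nonpos_at_sup (F := fun x t => -θ t x) (fun x => (hK x).neg) (fun t ht => ?_)
      (fun x => by rw [hθ.initial]; exact (neg_le_abs _).trans (hH x)) ?_
    · exact ⟨_, by rintro _ ⟨x, rfl⟩; exact (neg_le_abs _).trans ((hA t ht).abs_le x)⟩
    · filter_upwards [hθ.equation, ae_restrict_mem measurableSet_Ioo] with t ht htI s hs hlub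
      have htT := Ioo_subset_Icc_self htI
      obtain ⟨x, hx, hmax⟩ := exists_eq_of_isLUB_of_tendsto_zero (hA t htT).continuous.neg
        (neg_zero (G := ℝ) ▸ (hA t htT).tendsto_zero.neg) (hH0.trans_lt hs) hlub
      have hmin : ∀ y, θ t x ≤ θ t y := fun y => neg_le_neg_iff.1 (hmax y)
      obtain ⟨d, hd, heq⟩ := ht x
      refine ⟨x, hx, -d, ?_, hd.neg⟩
      have h1 : fderiv ℝ (θ t) x = 0 := IsLocalMin.fderiv_eq_zero (.of_forall hmin)
      have h2 := fracLaplacian_nonpos_of_min hβ₀ hβ₁ (hA t htT) hmin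
      rw [h1] at heq
      simp only [zero_apply] at heq
      linarith
  intro t ht x
  exact _root_.abs_le.2 ⟨by linarith [hlo t ht x], hup t ht x⟩

end IsSmoothSolution

/-! ### Maximal Hölder quotients and their evolution -/

/-- The pair `(x, y)` maximizes the Hölder quotient of exponent `a` of `f`, with the value `S`. -/
structure IsHolderContact (a S : ℝ) (f : Plane → ℝ) (x y : Plane) : Prop where
  ne : x ≠ y
  eq : f x - f y = S * ‖x - y‖ ^ a
  le : ∀ x' y', f x' - f y' ≤ S * ‖x' - y'‖ ^ a

/-- Compactness of the pairs with quotient above s/2. If one point is far out, either the other is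
outside the ball of radius `R₁` too, and both values are tiny compared with η^a, or the points are
at least `R₂` apart, and boundedness makes the quotient small. -/
theorem exists_eq_of_isLUB_quotient {f : Plane → ℝ} {a η s B : ℝ} (hf : Continuous f)
    (h0 : Filter.Tendsto f (Filter.cocompact Plane) (nhds 0)) (hB : ∀ x, |f x| ≤ B) (ha : 0 < a)
    (hη : 0 < η) (hs : 0 < s)
    (hlub : IsLUB (range fun p : {p : Plane × Plane // η ≤ ‖p.1 - p.2‖} =>
      (f p.1.1 - f p.1.2) / ‖p.1.1 - p.1.2‖ ^ a) s) :
    ∃ p : {p : Plane × Plane // η ≤ ‖p.1 - p.2‖},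
      (f p.1.1 - f p.1.2) / ‖p.1.1 - p.1.2‖ ^ a = s := by
  set X : Set (Plane × Plane) := {p | η ≤ ‖p.1 - p.2‖} with hX
  set q : Plane × Plane → ℝ := fun p => (f p.1 - f p.2) / ‖p.1 - p.2‖ ^ a with hq
  have hB0 : 0 ≤ B := (abs_nonneg _).trans (hB 0)
  obtain ⟨_, ⟨p₀, rfl⟩, hp₀, -⟩ := hlub.exists_between (half_lt_self hs)
  have hpos : ∀ p ∈ X, 0 < ‖p.1 - p.2‖ := fun p hp => hη.trans_le hp
  obtain ⟨R₁, hR₁⟩ : ∃ R₁ : ℝ, ∀ x : Plane, R₁ < ‖x‖ → |f x| ≤ s * η ^ a / 4 := by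
    have hε : 0 < s * η ^ a / 4 := by positivity
    have h1 := (tendsto_zero_iff_abs_tendsto_zero f).1 h0 |>.eventually_le_const hε
    rw [← Metric.cobounded_eq_cocompact, ← comap_norm_atTop, Filter.eventually_comap] at h1
    obtain ⟨R, hR⟩ := Filter.eventually_atTop.1 h1
    exact ⟨R, fun x hx => hR _ hx.le x rfl⟩
  obtain ⟨R₂, hR₂, hR₂0⟩ : ∃ R₂ : ℝ, 2 * B ≤ s / 2 * R₂ ^ a ∧ 0 < R₂ := by
    have h1 := ((tendsto_rpow_atTop ha).eventually_ge_atTop (2 * B / (s / 2))).and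
      (Filter.eventually_gt_atTop 0)
    obtain ⟨R, hR, hR0⟩ := h1.exists
    exact ⟨R, by rwa [div_le_iff₀' (half_pos hs)] at hR, hR0⟩
  set R := max R₁ 0 + R₂ with hR
  have hRR₁ : R₁ < R := by have := le_max_left R₁ 0; linarith
  have hout : ∀ p ∈ X, (R < ‖p.1‖ ∨ R < ‖p.2‖) → q p ≤ s / 2 := by
    intro p hp hpR
    have hd := hpos p hp
    rw [hq]
    simp only
    rw [div_le_iff₀ (by positivity)]
    have hdiff : f p.1 - f p.2 ≤ |f p.1| + |f p.2| := by
      have := le_abs_self (f p.1)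
      have := neg_abs_le (f p.2)
      linarith
    have hfar : R₂ ≤ ‖p.1 - p.2‖ → f p.1 - f p.2 ≤ s / 2 * ‖p.1 - p.2‖ ^ a := fun h => by
      have h1 : s / 2 * R₂ ^ a ≤ s / 2 * ‖p.1 - p.2‖ ^ a := by gcongr
      have := hB p.1
      have := hB p.2
      linarith
    have hclose : R₁ < ‖p.1‖ → R₁ < ‖p.2‖ → f p.1 - f p.2 ≤ s / 2 * ‖p.1 - p.2‖ ^ a :=
      fun h h' => by
        have h1 : s / 2 * η ^ a ≤ s / 2 * ‖p.1 - p.2‖ ^ a := by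
          have : η ≤ ‖p.1 - p.2‖ := hp
          gcongr
        have := hR₁ _ h
        have := hR₁ _ h'
        linarith
    have hm := le_max_left R₁ 0
    rcases hpR with h | h
    · rcases le_or_gt ‖p.2‖ R₁ with h' | h'
      · exact hfar (by have := norm_sub_norm_le p.1 p.2; linarith)
      · exact hclose (hRR₁.trans h) h'
    · rcases le_or_gt ‖p.1‖ R₁ with h' | h'
      · exact hfar (by have := norm_sub_norm_le p.2 p.1; rw [norm_sub_rev] at this; linarith)
      · exact hclose h' (hRR₁.trans h)
  have hXc : IsClosed X := isClosed_le continuous_const (by fun_prop)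
  set Kc : Set (Plane × Plane) := (Metric.closedBall 0 R ×ˢ Metric.closedBall 0 R) ∩ X with hKc
  have hK : IsCompact Kc :=
    ((isCompact_closedBall 0 R).prod (isCompact_closedBall 0 R)).inter_right hXc
  have hin : ∀ p ∈ X, s / 2 < q p → p ∈ Kc := by
    intro p hp hqp
    have := mt (hout p hp) (not_le.2 hqp)
    push Not at this
    exact ⟨⟨by simpa using this.1, by simpa using this.2⟩, hp⟩
  have hqc : ContinuousOn q Kc := by
    refine ContinuousOn.div (by fun_prop) ?_ fun p hp => (Real.rpow_pos_of_pos (hpos p hp.2) _).ne'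
    exact ContinuousOn.rpow_const (by fun_prop) fun p hp => Or.inl (hpos p hp.2).ne'
  obtain ⟨p, hpK, hpmax⟩ := hK.exists_isMaxOn ⟨p₀.1, hin _ p₀.2 hp₀⟩ hqc
  refine ⟨⟨p, hpK.2⟩, le_antisymm (hlub.1 ⟨⟨p, hpK.2⟩, rfl⟩) (hlub.2 ?_)⟩
  rintro _ ⟨p', rfl⟩
  rcases le_or_gt (q p'.1) (s / 2) with h | h
  · exact h.trans (hp₀.le.trans (hpmax (hin _ p₀.2 hp₀)))
  · exact hpmax (hin _ p'.2 h)

/-- A Hölder bound persists if, at almost every time, the difference quotient cannot increase at a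
point of maximum where it exceeds that bound. -/
theorem IsSmoothSolution.holder_of_contact {β T : ℝ} {w : ℝ → Plane → Plane} {θ₀ : Plane → ℝ}
    {θ : ℝ → Plane → ℝ} (hθ : IsSmoothSolution β T w θ₀ θ) {a s₀ : ℝ} (ha0 : 0 < a) (ha1 : a < 1)
    (hs₀ : 0 < s₀) (h0 : ∀ x y, θ₀ x - θ₀ y ≤ s₀ * ‖x - y‖ ^ a)
    (hc : ∀ᵐ t ∂(volume.restrict (Ioo 0 T)), ∀ S > s₀, ∀ x y, IsHolderContact a S (θ t) x y →
      ∃ d ≤ 0, HasDerivAt (fun r => θ r x - θ r y) d t) :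
    ∀ t ∈ Icc 0 T, ∀ x y, |θ t x - θ t y| ≤ s₀ * ‖x - y‖ ^ a := by
  obtain ⟨A, hA⟩ := hθ.fourierDecay
  obtain ⟨K, hK⟩ := hθ.lipschitz_time
  set B := 2 * Real.pi * (A * ∫ ξ : Plane, ‖ξ‖ ^ (1 : ℝ) * (1 + ‖ξ‖) ^ (-4 : ℝ)) with hB
  have hLip : ∀ t ∈ Icc 0 T, ∀ x y, |θ t x - θ t y| ≤ B * ‖x - y‖ := fun t ht =>
    (hA t ht).abs_sub_le
  -- Below distance η the Lipschitz bound is stronger than s₀|x − y|^a, because a < 1. So only pairs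
  -- at distance at least η matter, and there the quotients are uniformly Lipschitz in time. η
  -- depends on the solution, but the conclusion does not.
  set η := (s₀ / (|B| + 1)) ^ (1 / (1 - a)) with hη
  have hη0 : 0 < η := by positivity
  have hsmall : ∀ t ∈ Icc 0 T, ∀ x y, ‖x - y‖ < η → θ t x - θ t y ≤ s₀ * ‖x - y‖ ^ a := by
    intro t ht x y hxy
    rcases eq_or_ne x y with rfl | hne
    · simp [Real.zero_rpow ha0.ne']
    have hξ : 0 < ‖x - y‖ := norm_pos_iff.2 (sub_ne_zero.2 hne)
    have h1 : ‖x - y‖ ^ (1 - a) ≤ s₀ / (|B| + 1) := by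
      calc ‖x - y‖ ^ (1 - a) ≤ η ^ (1 - a) :=
            Real.rpow_le_rpow hξ.le hxy.le (by linarith)
        _ = s₀ / (|B| + 1) := by
            rw [hη, ← Real.rpow_mul (by positivity), one_div_mul_cancel (by linarith),
              Real.rpow_one]
    rw [le_div_iff₀ (by positivity)] at h1
    have h2 : ‖x - y‖ = ‖x - y‖ ^ (1 - a) * ‖x - y‖ ^ a := by
      rw [← Real.rpow_add hξ]; simp
    calc θ t x - θ t y ≤ B * ‖x - y‖ := (le_abs_self _).trans (hLip t ht x y)
      _ ≤ (|B| + 1) * ‖x - y‖ := by gcongr; linarith [le_abs_self B]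
      _ = ‖x - y‖ ^ (1 - a) * (|B| + 1) * ‖x - y‖ ^ a := by nth_rewrite 1 [h2]; ring
      _ ≤ _ := by gcongr
  set F : {p : Plane × Plane // η ≤ ‖p.1 - p.2‖} → ℝ → ℝ := fun p t =>
    (θ t p.1.1 - θ t p.1.2) / ‖p.1.1 - p.1.2‖ ^ a with hF
  have hpos : ∀ p : {p : Plane × Plane // η ≤ ‖p.1 - p.2‖}, 0 < ‖p.1.1 - p.1.2‖ := fun p =>
    hη0.trans_le p.2
  have hmain : ∀ t ∈ Icc 0 T, ∀ p, F p t ≤ s₀ := by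
    refine le_of_deriv_nonpos_at_sup (K := ((2 * K / η ^ a : ℝ)).toNNReal) (fun p => ?_)
      (fun t ht => ?_) (fun p => ?_) ?_
    · refine LipschitzOnWith.of_dist_le_mul fun t ht t' ht' => ?_
      have h1 := (hK p.1.1).dist_le_mul t ht t' ht'
      have h2 := (hK p.1.2).dist_le_mul t ht t' ht'
      rw [Real.coe_toNNReal _ (by positivity)]
      simp only [Real.dist_eq, hF] at h1 h2 ⊢
      have h3 : η ^ a ≤ ‖p.1.1 - p.1.2‖ ^ a := Real.rpow_le_rpow hη0.le p.2 ha0.le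
      rw [← sub_div, abs_div, abs_of_pos (Real.rpow_pos_of_pos (hpos p) a)]
      have h4 : |θ t p.1.1 - θ t p.1.2 - (θ t' p.1.1 - θ t' p.1.2)| ≤ 2 * K * |t - t'| := by
        rw [show θ t p.1.1 - θ t p.1.2 - (θ t' p.1.1 - θ t' p.1.2) =
          (θ t p.1.1 - θ t' p.1.1) - (θ t p.1.2 - θ t' p.1.2) by ring]
        refine (abs_sub _ _).trans ?_
        linarith
      calc _ ≤ 2 * K * |t - t'| / η ^ a := by gcongr
        _ = _ := by ring
    · refine ⟨2 * (A * ∫ ξ : Plane, ‖ξ‖ ^ (0 : ℝ) * (1 + ‖ξ‖) ^ (-4 : ℝ)) / η ^ a, ?_⟩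
      rintro _ ⟨p, rfl⟩
      have h1 := (hA t ht).abs_le p.1.1
      have h2 := (hA t ht).abs_le p.1.2
      have h3 : η ^ a ≤ ‖p.1.1 - p.1.2‖ ^ a := Real.rpow_le_rpow hη0.le p.2 ha0.le
      have h4 : θ t p.1.1 - θ t p.1.2 ≤
          2 * (A * ∫ ξ : Plane, ‖ξ‖ ^ (0 : ℝ) * (1 + ‖ξ‖) ^ (-4 : ℝ)) := by
        have := (abs_le.1 h1).2
        have := (abs_le.1 h2).1
        linarith
      have h5 : 0 ≤ 2 * (A * ∫ ξ : Plane, ‖ξ‖ ^ (0 : ℝ) * (1 + ‖ξ‖) ^ (-4 : ℝ)) := by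
        have := (abs_nonneg _).trans h1
        linarith
      simp only [hF]
      gcongr
    · simp only [hF]
      rw [div_le_iff₀ (Real.rpow_pos_of_pos (hpos p) a), hθ.initial]
      exact h0 _ _
    · filter_upwards [hc, ae_restrict_mem measurableSet_Ioo] with t ht htI S hS hlub
      have htT := Ioo_subset_Icc_self htI
      obtain ⟨p, hp⟩ := exists_eq_of_isLUB_quotient (hA t htT).continuous (hA t htT).tendsto_zero
        (hA t htT).abs_le ha0 hη0 (hs₀.trans hS) hlub
      have hne : p.1.1 ≠ p.1.2 := sub_ne_zero.1 (norm_pos_iff.1 (hpos p))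
      have hpa := Real.rpow_pos_of_pos (hpos p) a
      -- The maximum over separated pairs is one over all pairs: closer pairs obey the bound with s₀
      -- < S.
      obtain ⟨d, hd, hder⟩ := ht S hS p.1.1 p.1.2 ⟨hne, (div_eq_iff hpa.ne').1 hp, fun x' y' => by
        rcases lt_or_ge ‖x' - y'‖ η with h | h
        · refine (hsmall t htT x' y' h).trans ?_
          gcongr
        · have h1 := hlub.1 ⟨⟨(x', y'), h⟩, rfl⟩
          simp only at h1
          exact (div_le_iff₀ (Real.rpow_pos_of_pos (hη0.trans_le h) a)).1 h1⟩
      exact ⟨p, hp, d / ‖p.1.1 - p.1.2‖ ^ a, div_nonpos_of_nonpos_of_nonneg hd hpa.le,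
        hder.div_const _⟩
  have hone : ∀ t ∈ Icc 0 T, ∀ x y, θ t x - θ t y ≤ s₀ * ‖x - y‖ ^ a := by
    intro t ht x y
    rcases lt_or_ge ‖x - y‖ η with h | h
    · exact hsmall t ht x y h
    · exact (div_le_iff₀ (Real.rpow_pos_of_pos (hη0.trans_le h) a)).1 (hmain t ht ⟨(x, y), h⟩)
  intro t ht x y
  have := hone t ht y x
  rw [norm_sub_rev] at this
  exact abs_le.2 ⟨by linarith, hone t ht x y⟩

theorem hasFDerivAt_norm_rpow_of_ne {z : Plane} (hz : z ≠ 0) (a : ℝ) :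
    HasFDerivAt (fun z : Plane => ‖z‖ ^ a) ((a * ‖z‖ ^ (a - 2)) • innerSL ℝ z) z := by
  have hz' : 0 < ‖z‖ := norm_pos_iff.2 hz
  have hpow : ∀ (y : Plane) (p : ℝ), (‖y‖ ^ 2) ^ p = ‖y‖ ^ (2 * p) := fun y p => by
    rw [← Real.rpow_natCast, ← Real.rpow_mul (norm_nonneg _)]; norm_num
  have h1 : HasFDerivAt (fun z : Plane => ‖z‖ ^ 2) (2 • innerSL ℝ z) z :=
    (hasStrictFDerivAt_norm_sq z).hasFDerivAt
  have h2 := h1.rpow_const (p := a / 2) (Or.inl (by positivity))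
  refine (h2.congr_fderiv ?_).congr_of_eventuallyEq (.of_forall fun y => ?_)
  · ext v
    simp only [smul_apply, hpow, nsmul_eq_mul, smul_eq_mul]
    rw [show 2 * (a / 2 - 1) = a - 2 by ring]
    push_cast
    ring
  · simp only [hpow]
    ring_nf

/-- First-order conditions in each variable separately: S|x − y|^a touches the difference from above
at the pair, and its gradients in x and in y are opposite. -/
theorem IsHolderContact.fderiv_eq {a S : ℝ} {f : Plane → ℝ} {x y : Plane}
    (h : IsHolderContact a S f x y) (hf : Differentiable ℝ f) :
    fderiv ℝ f x = (S * (a * ‖x - y‖ ^ (a - 2))) • innerSL ℝ (x - y) ∧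
      fderiv ℝ f y = (S * (a * ‖x - y‖ ^ (a - 2))) • innerSL ℝ (x - y) := by
  have hx : HasFDerivAt (fun x' => S * ‖x' - y‖ ^ a)
      ((S * (a * ‖x - y‖ ^ (a - 2))) • innerSL ℝ (x - y)) x := by
    have := ((hasFDerivAt_norm_rpow_of_ne (sub_ne_zero.2 h.ne) a).comp x
      ((hasFDerivAt_id x).sub_const y)).const_mul S
    refine this.congr_fderiv ?_
    ext v; simp; ring
  have hy : HasFDerivAt (fun y' => S * ‖x - y'‖ ^ a)
      (-((S * (a * ‖x - y‖ ^ (a - 2))) • innerSL ℝ (x - y))) y := by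
    have := ((hasFDerivAt_norm_rpow_of_ne (sub_ne_zero.2 h.ne) a).comp y
      ((hasFDerivAt_id y).const_sub x)).const_mul S
    refine this.congr_fderiv ?_
    ext v; simp; ring
  constructor
  · have hmax : IsLocalMax (fun x' => f x' - S * ‖x' - y‖ ^ a) x := .of_forall fun x' => by
      have h1 := h.le x' y
      have h2 := h.eq
      simp only
      linarith
    have := hmax.hasFDerivAt_eq_zero ((hf x).hasFDerivAt.sub hx)
    exact sub_eq_zero.1 this
  · have hmin : IsLocalMin (fun y' => f y' + S * ‖x - y'‖ ^ a) y := .of_forall fun y' => by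
      have h1 := h.le x y'
      have h2 := h.eq
      simp only
      linarith
    have := hmin.hasFDerivAt_eq_zero ((hf y).hasFDerivAt.add hy)
    rw [← sub_eq_add_neg] at this
    exact sub_eq_zero.1 this

/-- Subtracting the equations at x and y, the common gradient leaves only the velocity difference,
of which only the component along x − y counts; the dissipative terms combine into D. The length ρ
at which the velocity is split stays free, and so does the Hölder pair (α, Q), which need not be the
maximized one. -/
theorem IsHolderContact.deriv_le {a S A β M α Q ρ t : ℝ} {w : Plane → Plane}
    {θ : ℝ → Plane → ℝ} {x y : Plane} (h : IsHolderContact a S (θ t) x y) (hβ₀ : 0 < β)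
    (hβ₁ : β ≤ 1) (ha : 0 < a) (hS : 0 < S) (hf : FourierDecay A (θ t))
    (hd : Differentiable ℝ (θ t)) (hw : ∀ x y, ‖w x - w y‖ ≤ M * ‖x - y‖)
    (heq : ∀ x : Plane, ∃ θt : ℝ, HasDerivAt (fun s => θ s x) θt t ∧
      θt + fderiv ℝ (θ t) x (w x + inducedVelocity β (θ t) x) + fracLaplacian β (θ t) x = 0)
    (hα0 : 0 ≤ α) (hα : α ≤ β / 2) (hQ0 : 0 ≤ Q)
    (hQ : ∀ x y, |θ t x - θ t y| ≤ Q * ‖x - y‖ ^ α) (hρ : 0 < ρ) :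
    ∃ d, HasDerivAt (fun r => θ r x - θ r y) d t ∧
      d ≤ a * ((θ t x - θ t y) / ‖x - y‖) * (M * ‖x - y‖ + velocityConst β *
        (ρ * dissipation β (θ t) x y + ‖x - y‖ * Q * ρ ^ (α - β))) -
          fracConst β * dissipation β (θ t) x y := by
  have hξ : 0 < ‖x - y‖ := norm_pos_iff.2 (sub_ne_zero.2 h.ne)
  -- A translated pair has the same separation.
  have htr : ∀ z, θ t (x - z) - θ t (y - z) ≤ θ t x - θ t y := fun z => by
    have := h.le (x - z) (y - z)
    rwa [sub_sub_sub_cancel_right, ← h.eq] at this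
  obtain ⟨dx, hdx, hx⟩ := heq x
  obtain ⟨dy, hdy, hy⟩ := heq y
  obtain ⟨hfx, hfy⟩ := h.fderiv_eq hd
  have hΛ := fracLaplacian_sub hβ₀ hβ₁ hf x y
  have hv := norm_inducedVelocity_sub_le hβ₀ hβ₁ hf htr hα0 hα hQ0 hQ hρ
  refine ⟨dx - dy, hdx.sub hdy, ?_⟩
  rw [hfx] at hx
  rw [hfy] at hy
  set u := (w x - w y) + (inducedVelocity β (θ t) x - inducedVelocity β (θ t) y) with hu
  have hu_le : ‖u‖ ≤ M * ‖x - y‖ + velocityConst β *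
      (ρ * dissipation β (θ t) x y + ‖x - y‖ * Q * ρ ^ (α - β)) :=
    (norm_add_le _ _).trans (add_le_add (hw x y) hv)
  have hN : S * (a * ‖x - y‖ ^ (a - 2)) * ‖x - y‖ = a * ((θ t x - θ t y) / ‖x - y‖) := by
    rw [h.eq, show a - 2 = a - 1 - 1 by ring, Real.rpow_sub_one hξ.ne', Real.rpow_sub_one hξ.ne']
    field_simp
  have hin : -((S * (a * ‖x - y‖ ^ (a - 2))) * inner ℝ (x - y) u) ≤
      a * ((θ t x - θ t y) / ‖x - y‖) * ‖u‖ := by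
    have hk : 0 ≤ S * (a * ‖x - y‖ ^ (a - 2)) := by positivity
    have hi : -inner ℝ (x - y) u ≤ ‖x - y‖ * ‖u‖ :=
      (neg_le_abs _).trans (abs_real_inner_le_norm _ _)
    rw [← hN]
    linarith [mul_le_mul_of_nonneg_left hi hk]
  have hg : 0 ≤ a * ((θ t x - θ t y) / ‖x - y‖) := by rw [← hN]; positivity
  have hsplit : dx - dy = -((S * (a * ‖x - y‖ ^ (a - 2))) * inner ℝ (x - y) u) -
      (fracLaplacian β (θ t) x - fracLaplacian β (θ t) y) := by
    simp only [smul_apply, innerSL_apply_apply, smul_eq_mul, inner_add_right] at hx hy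
    simp only [hu, inner_add_right, inner_sub_right] at *
    linear_combination hx - hy
  rw [hsplit, hΛ]
  have := mul_le_mul_of_nonneg_left hu_le hg
  linarith

/-! ### A priori Hölder and Lipschitz bounds -/

/-- The data of the a priori estimate: a solution whose drift is Lipschitz with constant `M`, and
whose initial value is bounded by `H` and Lipschitz with constant `g`. -/
structure IsBoundedSolution (β T M H g : ℝ) (w : ℝ → Plane → Plane) (θ₀ : Plane → ℝ)
    (θ : ℝ → Plane → ℝ) : Prop where
  solution : IsSmoothSolution β T w θ₀ θ
  drift : ∀ᵐ t ∂(volume.restrict (Ioo 0 T)), ∀ x y, ‖w t x - w t y‖ ≤ M * ‖x - y‖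
  initial_le : ∀ x, |θ₀ x| ≤ H
  initial_sub_le : ∀ x y, |θ₀ x - θ₀ y| ≤ g * ‖x - y‖

theorem IsBoundedSolution.initial_sub_le_two_mul {β T M H g : ℝ} {w : ℝ → Plane → Plane}
    {θ₀ : Plane → ℝ} {θ : ℝ → Plane → ℝ} (h : IsBoundedSolution β T M H g w θ₀ θ) (x y : Plane) :
    θ₀ x - θ₀ y ≤ 2 * H := by
  have := (abs_le.1 (h.initial_le x)).2
  have := (abs_le.1 (h.initial_le y)).1
  linarith

theorem IsBoundedSolution.sub_le_two_mul {β T M H g : ℝ} {w : ℝ → Plane → Plane}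
    {θ₀ : Plane → ℝ} {θ : ℝ → Plane → ℝ} (h : IsBoundedSolution β T M H g w θ₀ θ) (hβ₀ : 0 < β)
    (hβ₁ : β ≤ 1) {t : ℝ} (ht : t ∈ Icc 0 T) (x y : Plane) : θ t x - θ t y ≤ 2 * H := by
  have hb := h.solution.abs_le_of_initial hβ₀ hβ₁ h.initial_le t ht
  have := (abs_le.1 (hb x)).2
  have := (abs_le.1 (hb y)).1
  linarith

/-- Hölder continuity with a small exponent, depending only on the bounds of the data. -/
theorem exists_holder_bound {β M H g : ℝ} (hβ₀ : 0 < β) (hβ₁ : β ≤ 1) (hM : 0 ≤ M) (hH : 0 ≤ H)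
    (hg : 0 ≤ g) :
    ∃ α Q : ℝ, 0 < α ∧ α ≤ β / 2 ∧ 0 < Q ∧ ∀ (T : ℝ) (w : ℝ → Plane → Plane) (θ₀ : Plane → ℝ)
      (θ : ℝ → Plane → ℝ), IsBoundedSolution β T M H g w θ₀ θ →
        ∀ t ∈ Icc 0 T, ∀ x y, |θ t x - θ t y| ≤ Q * ‖x - y‖ ^ α := by
  have hc := fracConst_pos hβ₀ hβ₁
  have hV := velocityConst_pos hβ₀ hβ₁
  set c := fracConst β
  set V := velocityConst β
  -- As α ≤ 1/2, this gives R^(α−1) ≤ 1/4096, so by time (Rξ)² smoothing has halved the difference.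
  -- Half of the resulting dissipation is at least κNξ^(−β).
  set R : ℝ := 4096 ^ 2 with hR
  have hR0 : 0 < R := by norm_num [hR]
  set κ := c / (2 * β) * R ^ (-β) with hκ
  have hκ0 : 0 < κ := by positivity
  -- The coefficient of both velocity terms is αVN ≤ 2αVH. It must not exceed c/2, for the term in
  -- D, nor κ/2, for the far term.
  set α := min (β / 2) (min c κ / (4 * V * (H + 1))) with hα
  have hα0 : 0 < α := by positivity
  have hαβ : α ≤ β / 2 := min_le_left _ _
  have hαm : α * (V * (2 * H)) ≤ min c κ / 2 := by
    calc α * (V * (2 * H)) ≤ min c κ / (4 * V * (H + 1)) * (V * (2 * (H + 1))) := by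
          gcongr
          · exact min_le_right _ _
          · linarith
      _ = min c κ / 2 := by field_simp; ring
  -- At distances up to ξ₀ the drift term αMN is below half of κNξ^(−β).
  set ξ₀ := (κ / (2 * (M + 1))) ^ (1 / β) with hξ₀
  have hξ₀0 : 0 < ξ₀ := by positivity
  have hξ₀β : ξ₀ ^ β * (2 * (M + 1)) = κ := by
    rw [hξ₀, ← Real.rpow_mul (by positivity), one_div_mul_cancel hβ₀.ne', Real.rpow_one]
    field_simp
  -- The first summand rules out maximizing pairs farther apart than ξ₀, since differences never
  -- exceed 2H; the second takes care of nearby points of the initial value; the last makes Q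
  -- positive.
  set Q := 2 * H / ξ₀ ^ α + g * ξ₀ ^ (1 - α) + 1 with hQ
  have hQ0 : 0 < Q := by positivity
  have hQ1 : 2 * H ≤ Q * ξ₀ ^ α := by
    rw [← div_le_iff₀ (by positivity), hQ]
    have : 0 ≤ g * ξ₀ ^ (1 - α) := by positivity
    linarith
  have hQ2 : g * ξ₀ ^ (1 - α) ≤ Q := by
    have : 0 ≤ 2 * H / ξ₀ ^ α := by positivity
    linarith
  refine ⟨α, Q, hα0, hαβ, hQ0, fun T w θ₀ θ hθ => ?_⟩
  obtain ⟨A, hA⟩ := hθ.solution.fourierDecay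
  refine hθ.solution.holder_of_contact hα0 (by linarith) hQ0 (fun x y => ?_) ?_
  · rcases le_or_gt ‖x - y‖ ξ₀ with hle | hgt
    · rcases eq_or_ne x y with rfl | hne
      · simp [Real.zero_rpow hα0.ne']
      have hξ : 0 < ‖x - y‖ := norm_pos_iff.2 (sub_ne_zero.2 hne)
      have hsplit : ‖x - y‖ = ‖x - y‖ ^ (1 - α) * ‖x - y‖ ^ α := by
        rw [← Real.rpow_add hξ]; simp
      calc θ₀ x - θ₀ y ≤ g * ‖x - y‖ := (le_abs_self _).trans (hθ.initial_sub_le x y)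
        _ = g * ‖x - y‖ ^ (1 - α) * ‖x - y‖ ^ α := by nth_rewrite 1 [hsplit]; ring
        _ ≤ g * ξ₀ ^ (1 - α) * ‖x - y‖ ^ α := by
          gcongr
          linarith
        _ ≤ Q * ‖x - y‖ ^ α := by gcongr
    · calc θ₀ x - θ₀ y ≤ 2 * H := hθ.initial_sub_le_two_mul x y
        _ ≤ Q * ξ₀ ^ α := hQ1
        _ ≤ Q * ‖x - y‖ ^ α := by gcongr
  · filter_upwards [hθ.drift, hθ.solution.equation, ae_restrict_mem measurableSet_Ioo]
      with t hw heq htI S hS x y hxy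
    have ht := Ioo_subset_Icc_self htI
    have hf := hA t ht
    have hξ : 0 < ‖x - y‖ := norm_pos_iff.2 (sub_ne_zero.2 hxy.ne)
    have hS0 : 0 < S := hQ0.trans hS
    have hhold : ∀ x y, |θ t x - θ t y| ≤ S * ‖x - y‖ ^ α := fun x y => by
      have h1 := hxy.le x y
      have h2 := hxy.le y x
      rw [norm_sub_rev] at h2
      exact abs_le.2 ⟨by linarith, h1⟩
    -- The Hölder constant fed in is the current maximum S itself, and the split is at ρ = ξ, so
    -- near and far terms carry the same small factor αVN.
    obtain ⟨d, hd, hle⟩ := hxy.deriv_le hβ₀ hβ₁ hα0 hS0 hf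
      ((hθ.solution.smooth t ht).differentiable (by simp)) hw heq hα0.le hαβ hS0.le hhold hξ
    refine ⟨d, hle.trans ?_, hd⟩
    have htr : ∀ z, θ t (x - z) - θ t (y - z) ≤ θ t x - θ t y := fun z => by
      have := hxy.le (x - z) (y - z)
      rwa [sub_sub_sub_cancel_right, ← hxy.eq] at this
    have hD0 := dissipation_nonneg (β := β) hf htr
    set D := dissipation β (θ t) x y
    have hNH : θ t x - θ t y ≤ 2 * H := hθ.sub_le_two_mul hβ₀ hβ₁ ht x y
    have hNeq := hxy.eq
    set N := θ t x - θ t y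
    set ξ := ‖x - y‖
    have hN0 : 0 < N := by rw [hNeq]; positivity
    have hD : N / β * (R * ξ) ^ (-β) ≤ D := by
      refine le_dissipation hβ₀ hβ₁ hf htr hα0.le (by linarith) hS0.le hhold (by positivity) ?_
      have h1 : R ^ (α - 1) ≤ 1 / 4096 := by
        calc R ^ (α - 1) ≤ R ^ (-(1 / 2) : ℝ) :=
              Real.rpow_le_rpow_of_exponent_le (by norm_num [hR]) (by linarith)
          _ = 1 / 4096 := by
              rw [hR, ← Real.rpow_natCast, ← Real.rpow_mul (by norm_num)]
              norm_num [Real.rpow_neg_one]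
      have h2 : ξ ^ (α - 1) * ξ = ξ ^ α := by
        rw [Real.rpow_sub_one hξ.ne']; field_simp
      calc 2048 * (R * ξ) ^ (α - 1) * S * ξ = 2048 * R ^ (α - 1) * (S * (ξ ^ (α - 1) * ξ)) := by
            rw [Real.mul_rpow hR0.le hξ.le]; ring
        _ ≤ 2048 * (1 / 4096) * (S * (ξ ^ (α - 1) * ξ)) := by gcongr
        _ = N / 2 := by rw [h2, ← hNeq]; ring
    have hκD : κ * N * ξ ^ (-β) ≤ c / 2 * D := by
      calc κ * N * ξ ^ (-β) = c / 2 * (N / β * (R * ξ) ^ (-β)) := by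
            rw [hκ, Real.mul_rpow hR0.le hξ.le]; field_simp
        _ ≤ _ := by gcongr
    have hξle : ξ ≤ ξ₀ := by
      by_contra! hlt
      have h1 : Q * ξ₀ ^ α < S * ξ ^ α := by
        have : ξ₀ ^ α ≤ ξ ^ α := by gcongr
        have h3 : 0 < ξ₀ ^ α := by positivity
        nlinarith
      linarith
    have hMκ : α * M ≤ κ / 2 * ξ ^ (-β) := by
      rw [Real.rpow_neg hξ.le, ← div_eq_mul_inv, le_div_iff₀ (by positivity)]
      have h1 : ξ ^ β ≤ ξ₀ ^ β := by gcongr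
      have hα1 : α ≤ 1 := by linarith
      calc α * M * ξ ^ β ≤ 1 * (M + 1) * ξ₀ ^ β := by gcongr; linarith
        _ = κ / 2 := by rw [← hξ₀β]; ring
    have hVc : α * (V * N) ≤ c / 2 := by
      calc α * (V * N) ≤ α * (V * (2 * H)) := by gcongr
        _ ≤ min c κ / 2 := hαm
        _ ≤ c / 2 := by gcongr; exact min_le_left _ _
    have hVκ : α * (V * N) ≤ κ / 2 := by
      calc α * (V * N) ≤ α * (V * (2 * H)) := by gcongr
        _ ≤ min c κ / 2 := hαm
        _ ≤ κ / 2 := by gcongr; exact min_le_right _ _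
    have h3 : ξ * S * ξ ^ (α - β) = ξ * (N * ξ ^ (-β)) := by
      rw [hNeq, show α - β = α + -β by ring, Real.rpow_add hξ]
      ring
    have hp : 0 < ξ ^ (-β) := by positivity
    calc α * (N / ξ) * (M * ξ + V * (ξ * D + ξ * S * ξ ^ (α - β))) - c * D
        = α * M * N + α * (V * N) * D + α * (V * N) * (N * ξ ^ (-β)) - c * D := by
          rw [h3]
          field_simp
          ring
      _ ≤ κ / 2 * ξ ^ (-β) * N + c / 2 * D + κ / 2 * (N * ξ ^ (-β)) - c * D := by gcongr
      _ ≤ 0 := by linarith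

/-- Lipschitz continuity, depending only on the bounds of the data: the Hölder bound makes the
velocity subcritical, so that no smallness of shocks has to be assumed. -/
theorem exists_lipschitz_bound {β M H g : ℝ} (hβ₀ : 0 < β) (hβ₁ : β ≤ 1) (hM : 0 ≤ M) (hH : 0 ≤ H)
    (hg : 0 ≤ g) :
    ∃ G : ℝ, 0 ≤ G ∧ ∀ (T : ℝ) (w : ℝ → Plane → Plane) (θ₀ : Plane → ℝ)
      (θ : ℝ → Plane → ℝ), IsBoundedSolution β T M H g w θ₀ θ →
        ∀ t ∈ Icc 0 T, ∀ x y, |θ t x - θ t y| ≤ G * ‖x - y‖ := by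
  obtain ⟨α, Q, hα0, hαβ, hQ0, hhold⟩ := exists_holder_bound hβ₀ hβ₁ hM hH hg
  have hc := fracConst_pos hβ₀ hβ₁
  have hV := velocityConst_pos hβ₀ hβ₁
  set c := fracConst β
  set V := velocityConst β
  set κ := c / (2 * β) * (4096 * Q) ^ (-β) with hκ
  have hκ0 : 0 < κ := by positivity
  set L := V * Q * (c / (2 * V)) ^ (α - β) with hL
  -- Slopes γ ≥ G₀ satisfy M ≤ (κ/2)γ^β and L ≤ (κ/2)γ^α: drift and far velocity are each at most
  -- half of the part κγ^β of the dissipation.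
  obtain ⟨G₀, hG₀⟩ := Filter.eventually_atTop.1
    (((tendsto_rpow_atTop hβ₀).eventually_ge_atTop (M / (κ / 2))).and
      ((tendsto_rpow_atTop hα0).eventually_ge_atTop (L / (κ / 2))))
  set G := max G₀ (4096 * Q + g + 2 * H + 1) with hG
  have hG1 : 4096 * Q + g + 2 * H + 1 ≤ G := le_max_right _ _
  have hG0 : 0 < G := lt_of_lt_of_le (by positivity) hG1
  refine ⟨G, hG0.le, fun T w θ₀ θ hθ t ht x y => ?_⟩
  obtain ⟨A, hA⟩ := hθ.solution.fourierDecay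
  -- G is fixed before the exponent a, which makes the limit a → 1 possible.
  have key : ∀ a : ℝ, 0 < a → a < 1 → |θ t x - θ t y| ≤ G * ‖x - y‖ ^ a := by
    intro a ha0 ha1
    refine hθ.solution.holder_of_contact ha0 ha1 hG0 (fun x y => ?_) ?_ t ht x y
    · rcases le_or_gt ‖x - y‖ 1 with hle | hgt
      · have h1 : ‖x - y‖ ≤ ‖x - y‖ ^ a := by
          calc ‖x - y‖ = ‖x - y‖ ^ (1 : ℝ) := (Real.rpow_one _).symm
            _ ≤ ‖x - y‖ ^ a := Real.rpow_le_rpow_of_exponent_ge' (norm_nonneg _) hle ha0.le ha1.le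
        calc θ₀ x - θ₀ y ≤ g * ‖x - y‖ := (le_abs_self _).trans (hθ.initial_sub_le x y)
          _ ≤ G * ‖x - y‖ ^ a := by gcongr; linarith
      · have h1 : 1 ≤ ‖x - y‖ ^ a := Real.one_le_rpow hgt.le ha0.le
        have h2 := hθ.initial_sub_le_two_mul x y
        nlinarith
    · filter_upwards [hθ.drift, hθ.solution.equation, ae_restrict_mem measurableSet_Ioo]
        with t hw heq htI S hS x y hxy
      have ht := Ioo_subset_Icc_self htI
      have hf := hA t ht
      have hξ : 0 < ‖x - y‖ := norm_pos_iff.2 (sub_ne_zero.2 hxy.ne)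
      have hS0 : 0 < S := hG0.trans hS
      have hNH : θ t x - θ t y ≤ 2 * H := hθ.sub_le_two_mul hβ₀ hβ₁ ht x y
      have hNpos : 0 < θ t x - θ t y := by rw [hxy.eq]; positivity
      set γ := (θ t x - θ t y) / ‖x - y‖ with hγ
      have hγ0 : 0 < γ := by positivity
      -- At distance above 1 the difference would exceed G > 2H. Within distance 1 the actual slope
      -- γ is at least S, hence at least G.
      have hξ1 : ‖x - y‖ ≤ 1 := by
        by_contra! hlt
        have h1 : 1 ≤ ‖x - y‖ ^ a := Real.one_le_rpow hlt.le ha0.le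
        have h2 := hxy.eq
        nlinarith
      have hGγ : G ≤ γ := by
        have h1 : ‖x - y‖ ≤ ‖x - y‖ ^ a := by
          calc ‖x - y‖ = ‖x - y‖ ^ (1 : ℝ) := (Real.rpow_one _).symm
            _ ≤ ‖x - y‖ ^ a := Real.rpow_le_rpow_of_exponent_ge' (norm_nonneg _) hξ1 ha0.le ha1.le
        rw [hγ, le_div_iff₀ hξ, hxy.eq]
        have : G ≤ S := le_of_lt hS
        gcongr
      -- With this ρ the near part of the velocity consumes exactly half of the dissipation: γVρ =
      -- c/2.
      have hρ : 0 < c / (2 * V * γ) := by positivity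
      obtain ⟨d, hd, hle⟩ := hxy.deriv_le hβ₀ hβ₁ ha0 hS0 hf
        ((hθ.solution.smooth t ht).differentiable (by simp)) hw heq hα0.le hαβ hQ0.le
        (hhold T w θ₀ θ hθ t ht) hρ
      refine ⟨d, hle.trans ?_, hd⟩
      have htr : ∀ z, θ t (x - z) - θ t (y - z) ≤ θ t x - θ t y := fun z => by
        have := hxy.le (x - z) (y - z)
        rwa [sub_sub_sub_cancel_right, ← hxy.eq] at this
      have hD0 := dissipation_nonneg (β := β) hf htr
      have hNγ : θ t x - θ t y = γ * ‖x - y‖ := by rw [hγ]; field_simp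
      have hD : γ * ‖x - y‖ / β * (4096 * Q / γ) ^ (-β) ≤ dissipation β (θ t) x y := by
        rw [← hNγ]
        refine le_dissipation hβ₀ hβ₁ hf htr hα0.le (by linarith) hQ0.le (hhold T w θ₀ θ hθ t ht)
          (by positivity) ?_
        -- The smoothing length r = 4096Q/γ is at most 1, so r^(α−1) ≤ 1/r; only boundedness of the
        -- Hölder constant is needed here, not its exponent.
        have h1 : 4096 * Q / γ ≤ 1 := (div_le_one hγ0).2 (by linarith)
        have h2 : (4096 * Q / γ) ^ (α - 1) ≤ γ / (4096 * Q) := by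
          calc (4096 * Q / γ) ^ (α - 1) ≤ (4096 * Q / γ) ^ (-1 : ℝ) :=
                Real.rpow_le_rpow_of_exponent_ge (by positivity) h1 (by linarith)
            _ = γ / (4096 * Q) := by rw [Real.rpow_neg_one, inv_div]
        calc 2048 * (4096 * Q / γ) ^ (α - 1) * Q * ‖x - y‖
            ≤ 2048 * (γ / (4096 * Q)) * Q * ‖x - y‖ := by gcongr
          _ = _ := by rw [hNγ]; field_simp; norm_num
      set D := dissipation β (θ t) x y
      set ξ := ‖x - y‖
      obtain ⟨hγβ, hγα⟩ := hG₀ γ ((le_max_left _ _).trans hGγ)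
      rw [div_le_iff₀ (by positivity)] at hγβ hγα
      have hκD : κ * γ ^ β * (γ * ξ) ≤ c / 2 * D := by
        calc κ * γ ^ β * (γ * ξ) = c / 2 * (γ * ξ / β * (4096 * Q / γ) ^ (-β)) := by
              rw [hκ, div_eq_mul_inv (4096 * Q), Real.mul_rpow (x := 4096 * Q) (y := γ⁻¹)
                (by positivity) (by positivity), Real.inv_rpow hγ0.le, Real.rpow_neg hγ0.le, inv_inv]
              field_simp
          _ ≤ _ := by gcongr
      have hfar : V * (ξ * Q * (c / (2 * V * γ)) ^ (α - β)) ≤ κ / 2 * γ ^ β * ξ := by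
        have h1 : (c / (2 * V * γ)) ^ (α - β) = (c / (2 * V)) ^ (α - β) * γ ^ (β - α) := by
          rw [← div_div, div_eq_mul_inv _ γ, Real.mul_rpow (by positivity) (by positivity),
            Real.inv_rpow hγ0.le, ← Real.rpow_neg hγ0.le, neg_sub]
        calc _ = L * γ ^ (β - α) * ξ := by rw [h1, hL]; ring
          _ ≤ γ ^ α * (κ / 2) * γ ^ (β - α) * ξ := by gcongr
          _ = κ / 2 * (γ ^ α * γ ^ (β - α)) * ξ := by ring
          _ = κ / 2 * γ ^ β * ξ := by rw [← Real.rpow_add hγ0]; ring_nf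
      have hnear : γ * (V * (c / (2 * V * γ) * D)) = c / 2 * D := by field_simp
      have hMξ : M * ξ ≤ κ / 2 * γ ^ β * ξ := by gcongr; linarith
      have hpos : 0 ≤ M * ξ + V * (c / (2 * V * γ) * D + ξ * Q * (c / (2 * V * γ)) ^ (α - β)) := by
        positivity
      calc a * γ * (M * ξ + V * (c / (2 * V * γ) * D + ξ * Q * (c / (2 * V * γ)) ^ (α - β))) - c * D
          ≤ 1 * γ * (M * ξ + V * (c / (2 * V * γ) * D + ξ * Q * (c / (2 * V * γ)) ^ (α - β))) -
            c * D := by gcongr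
        _ = γ * (M * ξ + V * (ξ * Q * (c / (2 * V * γ)) ^ (α - β))) +
            γ * (V * (c / (2 * V * γ) * D)) - c * D := by ring
        _ ≤ γ * (κ / 2 * γ ^ β * ξ + κ / 2 * γ ^ β * ξ) +
            γ * (V * (c / (2 * V * γ) * D)) - c * D := by gcongr
        _ = κ * γ ^ β * (γ * ξ) + c / 2 * D - c * D := by rw [hnear]; ring
        _ ≤ 0 := by linarith
  have hlim : Filter.Tendsto (fun a : ℝ => G * ‖x - y‖ ^ a) (nhdsWithin 1 (Iio 1))
      (nhds (G * ‖x - y‖)) := by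
    have h1 : ContinuousAt (fun a : ℝ => ‖x - y‖ ^ a) 1 :=
      Real.continuousAt_const_rpow' one_ne_zero
    have h2 := (h1.tendsto.mono_left (nhdsWithin_le_nhds (s := Iio 1))).const_mul G
    simpa using h2
  refine ge_of_tendsto hlim ?_
  filter_upwards [Ioo_mem_nhdsLT (zero_lt_one' ℝ)] with a ha
  exact key a ha.1 ha.2

/-! ### From essential suprema to pointwise bounds and back -/

/-- The bound holds on a set of full measure, which is dense, and the set is closed by continuity.
-/
theorem norm_le_of_eLpNorm_top_le {F : Type*} [NormedAddCommGroup F] {g : Plane → F} {M : ℝ}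
    (hg : Continuous g) (hM0 : 0 ≤ M) (hM : eLpNorm g ⊤ volume ≤ ENNReal.ofReal M) (z : Plane) :
    ‖g z‖ ≤ M := by
  have h1 : ∀ᵐ z, ‖g z‖ ≤ M := by
    rw [eLpNorm_exponent_top] at hM
    filter_upwards [enorm_ae_le_eLpNormEssSup g volume] with z hz
    have := hz.trans hM
    rwa [← ofReal_norm, ENNReal.ofReal_le_ofReal_iff hM0] at this
  have hc : IsClosed {z | ‖g z‖ ≤ M} := isClosed_le hg.norm continuous_const
  have hd : Dense {z | ‖g z‖ ≤ M} := Measure.dense_of_ae h1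
  have : z ∈ closure {z | ‖g z‖ ≤ M} := hd z
  rwa [hc.closure_eq] at this

theorem norm_sub_le_of_eLpNorm_fderiv_le {F : Type*} [NormedAddCommGroup F] [NormedSpace ℝ F]
    {w : Plane → F} {M : ℝ} (hw : ContDiff ℝ 1 w) (hM0 : 0 ≤ M)
    (hM : eLpNorm (fderiv ℝ w) ⊤ volume ≤ ENNReal.ofReal M) (x y : Plane) :
    ‖w x - w y‖ ≤ M * ‖x - y‖ :=
  convex_univ.norm_image_sub_le_of_norm_fderiv_le (𝕜 := ℝ)
    (fun z _ => (hw.differentiable one_ne_zero) z)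
    (fun z _ => norm_le_of_eLpNorm_top_le (hw.continuous_fderiv one_ne_zero) hM0 hM z)
    (mem_univ y) (mem_univ x)

theorem eLpNorm_fderiv_top_le {f : Plane → ℝ} {G : ℝ} (hG : 0 ≤ G)
    (hf : ∀ x y, |f x - f y| ≤ G * ‖x - y‖) :
    eLpNorm (fderiv ℝ f) ⊤ volume ≤ ENNReal.ofReal G := by
  rw [eLpNorm_exponent_top]
  refine eLpNormEssSup_le_of_ae_bound (.of_forall fun x => ?_)
  have hlip : LipschitzWith G.toNNReal f := LipschitzWith.of_dist_le_mul fun x y => by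
    rw [Real.dist_eq, dist_eq_norm, Real.coe_toNNReal _ hG]
    exact hf x y
  simpa [Real.coe_toNNReal _ hG] using norm_fderiv_le_of_lipschitz ℝ hlip (x₀ := x)

/-- The real-valued constants carry information only when the extended norms are finite. For the
initial value this follows from the Fourier decay at time 0. -/
theorem IsSmoothSolution.isBoundedSolution {β T : ℝ} {w : ℝ → Plane → Plane} {θ₀ : Plane → ℝ}
    {θ : ℝ → Plane → ℝ} (hT : 0 < T) (hθ : IsSmoothSolution β T w θ₀ θ)
    (hw : ∀ᵐ t ∂(volume.restrict (Ioo 0 T)), ContDiff ℝ 1 (w t)) (hM : driftBound T w < ⊤) :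
    IsBoundedSolution β T (driftBound T w).toReal (eLpNorm θ₀ ⊤ volume).toReal
      (eLpNorm (fderiv ℝ θ₀) ⊤ volume).toReal w θ₀ θ := by
  obtain ⟨A, hA⟩ := hθ.fourierDecay
  have h0 : (0 : ℝ) ∈ Icc 0 T := ⟨le_rfl, hT.le⟩
  have hf : FourierDecay A θ₀ := hθ.initial ▸ hA 0 h0
  have hs : ContDiff ℝ ∞ θ₀ := hθ.initial ▸ hθ.smooth 0 h0
  refine ⟨hθ, ?_, fun x => ?_, fun x y => ?_⟩
  · have hess : ∀ᵐ t ∂(volume.restrict (Ioo 0 T)), eLpNorm (fderiv ℝ (w t)) ⊤ volume ≤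
        normLinftyLp T ⊤ (fun t => fderiv ℝ (w t)) := ae_le_essSup
    filter_upwards [hw, hess] with t hwt ht x y
    refine norm_sub_le_of_eLpNorm_fderiv_le hwt ENNReal.toReal_nonneg ?_ x y
    rw [ENNReal.ofReal_toReal hM.ne]
    exact ht.trans (le_max_right _ _)
  · refine norm_le_of_eLpNorm_top_le hf.continuous ENNReal.toReal_nonneg ?_ x
    refine (ENNReal.ofReal_toReal (ne_of_lt ?_)).ge
    rw [eLpNorm_exponent_top]
    exact eLpNormEssSup_lt_top_of_ae_bound (.of_forall hf.abs_le)
  · refine norm_sub_le_of_eLpNorm_fderiv_le (hs.of_le (by exact_mod_cast le_top))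
      ENNReal.toReal_nonneg ?_ x y
    refine (ENNReal.ofReal_toReal (ne_of_lt ?_)).ge
    have hI : 0 ≤ ∫ ξ : Plane, ‖ξ‖ ^ (1 : ℝ) * (1 + ‖ξ‖) ^ (-4 : ℝ) :=
      integral_nonneg fun ξ => by positivity
    have hA0 := hf.nonneg
    exact (eLpNorm_fderiv_top_le (by positivity) hf.abs_sub_le).trans_lt ENNReal.ofReal_lt_top

end

end GeneralizedSQG

theorem proposition3p2 (β : ℝ) (hβ₀ : 0 < β) (hβ₁ : β ≤ 1) :
    ∃ c : ℝ, 0 < c ∧ ∃ C : ℝ → ℝ → ℝ → ℝ → ℝ,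
      ∀ (T : ℝ), 0 < T →
      ∀ (w : ℝ → GeneralizedSQG.Plane → GeneralizedSQG.Plane),
        (∀ᵐ t ∂(volume.restrict (Ioo 0 T)),
          ContDiff ℝ 1 (w t) ∧ ∀ x, GeneralizedSQG.divergence (w t) x = 0) →
        GeneralizedSQG.driftBound T w < ⊤ →
      ∀ (θ₀ : GeneralizedSQG.Plane → ℝ) (θ : ℝ → GeneralizedSQG.Plane → ℝ),
        GeneralizedSQG.IsSmoothSolution β T w θ₀ θ →
        GeneralizedSQG.OSSUniformly
          (ENNReal.ofReal c / eLpNorm θ₀ ⊤ volume ^ (2 * β / (2 - β))) T θ →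
        GeneralizedSQG.normLinftyLp T ⊤ (fun t => fderiv ℝ (θ t)) ≤
          ENNReal.ofReal (C (GeneralizedSQG.driftBound T w).toReal
            (eLpNorm θ₀ ⊤ volume).toReal
            (eLpNorm (fderiv ℝ θ₀) ⊤ volume).toReal T) := by
  have hex : ∀ M H g : ℝ, ∃ G : ℝ, 0 ≤ M → 0 ≤ H → 0 ≤ g → 0 ≤ G ∧
      ∀ (T : ℝ) (w : ℝ → GeneralizedSQG.Plane → GeneralizedSQG.Plane)
        (θ₀ : GeneralizedSQG.Plane → ℝ) (θ : ℝ → GeneralizedSQG.Plane → ℝ),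
        GeneralizedSQG.IsBoundedSolution β T M H g w θ₀ θ →
          ∀ t ∈ Icc 0 T, ∀ x y, |θ t x - θ t y| ≤ G * ‖x - y‖ := by
    intro M H g
    by_cases h : 0 ≤ M ∧ 0 ≤ H ∧ 0 ≤ g
    · obtain ⟨G, hG⟩ := GeneralizedSQG.exists_lipschitz_bound hβ₀ hβ₁ h.1 h.2.1 h.2.2
      exact ⟨G, fun _ _ _ => hG⟩
    · exact ⟨0, fun h1 h2 h3 => absurd ⟨h1, h2, h3⟩ h⟩
  choose C hC using hex
  -- The Lipschitz bound is uniform in time, so `C` is constant in its last argument.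
  refine ⟨1, one_pos, fun M H g _ => C M H g, fun T hT w hw hM θ₀ θ hθ _ => ?_⟩
  obtain ⟨hG, hbound⟩ := hC (GeneralizedSQG.driftBound T w).toReal (eLpNorm θ₀ ⊤ volume).toReal
    (eLpNorm (fderiv ℝ θ₀) ⊤ volume).toReal ENNReal.toReal_nonneg ENNReal.toReal_nonneg
    ENNReal.toReal_nonneg
  have hb := hbound T w θ₀ θ (hθ.isBoundedSolution hT (hw.mono fun t ht => ht.1) hM)
  refine essSup_le_of_ae_le _ ((ae_restrict_mem measurableSet_Ioo).mono fun t ht => ?_)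
  exact GeneralizedSQG.eLpNorm_fderiv_top_le hG (hb t (Ioo_subset_Icc_self ht))
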